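/- Let $D$ be the open unit disc in $\mathbb{C}$ and let $H^2(D)$ be the Hardy space of holomorphic functions $f$ on $D$ with $\sup_{0<r<1}\int_0^{2\pi}|f(re^{i\theta})|^2\,\frac{d\theta}{2\pi}<\infty$, with inner product $\langle f,g\rangle=\lim_{r\to1^-}\int_0^{2\pi}f(re^{i\theta})\overline{g(re^{i\theta})}\,\frac{d\theta}{2\pi}$. An automorphism of $D$ (a biholomorphic bijection $D\to D$) is called elliptic if it is not the identity and has a fixed point in $D$. Let $\varphi$ be an elliptic automorphism of $D$ of order $2$ (i.e. $\varphi\circ\varphi=\mathrm{id}$, $\varphi\neq\mathrm{id}$) whose fixed point $a\in D$ is nonzero. Let $C_\varphi f=f\circ\varphi$ be the (bounded) composition operator on $H^2(D)$ and let $W(C_\varphi)=\{\langle C_\varphi f,f\rangle: f\in H^2(D),\ \|f\|=1\}$ be its numerical range. Then $W(C_\varphi)$ is the open ellipse (interior of the ellipse) with foci $\pm1$ and semi-major axis $\frac{1+|a|^2}{1-|a|^2}$, that is, $$W(C_\varphi)=\Big\{w\in\mathbb{C}: |w-1|+|w+1|<2\,\frac{1+|a|^2}{1-|a|^2}\Big\}.$$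 In particular, no boundary point of this ellipse belongs to $W(C_\varphi)$. -/

import Mathlib

open Complex Filter Topology Metric
open scoped UnitDisc ComplexConjugate

noncomputable section

namespace HardyDisc

/-- The extension by zero to `ℂ` of a function on the open unit disc. -/
def extendZero (f : 𝔻 → ℂ) : ℂ → ℂ := Function.extend ((↑) : 𝔻 → ℂ) f 0

@[simp] theorem extendZero_coe (f : 𝔻 → ℂ) (z : 𝔻) : extendZero f (z : ℂ) = f z :=
  UnitDisc.coe_injective.extend_apply f 0 z

theorem extendZero_of_norm_lt (f : 𝔻 → ℂ) {z : ℂ} (hz : ‖z‖ < 1) :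
    extendZero f z = f (UnitDisc.mk z hz) :=
  extendZero_coe f (UnitDisc.mk z hz)

/-- Holomorphy of a function on the open unit disc. -/
def IsHolomorphic (f : 𝔻 → ℂ) : Prop := DifferentiableOn ℂ (extendZero f) (ball 0 1)

theorem IsHolomorphic.comp {f : 𝔻 → ℂ} {φ : 𝔻 → 𝔻} (hf : IsHolomorphic f)
    (hφ : IsHolomorphic fun z => (φ z : ℂ)) : IsHolomorphic (f ∘ φ) := by
  have hmaps : Set.MapsTo (extendZero fun z => (φ z : ℂ)) (ball 0 1) (ball 0 1) := by
    intro z hz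
    rw [mem_ball_zero_iff] at hz ⊢
    rw [extendZero_of_norm_lt _ hz]
    exact (φ _).norm_lt_one
  refine (DifferentiableOn.comp hf hφ hmaps).congr ?_
  intro z hz
  rw [mem_ball_zero_iff] at hz
  simp [extendZero_of_norm_lt _ hz]

/-- The mean of `conj f * g` over the circle of radius `r` around `0`, that is
`∫_0^{2π} conj (f (r e^{iθ})) * g (r e^{iθ}) dθ / 2π`. -/
def circlePairing (f g : 𝔻 → ℂ) (r : ℝ) : ℂ :=
  Real.circleAverage (fun z => conj (extendZero f z) * extendZero g z) 0 r

/-- The square mean of `f` over the circle of radius `r` around `0`, that is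
`∫_0^{2π} |f (r e^{iθ})|² dθ / 2π`. -/
def circleSqMean (f : 𝔻 → ℂ) (r : ℝ) : ℝ :=
  Real.circleAverage (fun z => ‖extendZero f z‖ ^ 2) 0 r

/-! Auxiliary facts on means over circles. -/

theorem circleIntegrable_of_continuousOn {E : Type*} [NormedAddCommGroup E]
    {G : ℂ → E} (hG : ContinuousOn G (ball 0 1)) {r : ℝ} (hr0 : 0 ≤ r) (hr1 : r < 1) :
    CircleIntegrable G 0 r := by
  refine ContinuousOn.circleIntegrable hr0 (hG.mono ?_)
  intro z hz
  rw [mem_sphere_zero_iff_norm] at hz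
  rw [mem_ball_zero_iff]
  linarith

theorem extendZero_add (f g : 𝔻 → ℂ) (z : ℂ) :
    extendZero (f + g) z = extendZero f z + extendZero g z := by
  by_cases hz : ‖z‖ < 1
  · simp [extendZero_of_norm_lt _ hz]
  · have h : ¬ ∃ w : 𝔻, (w : ℂ) = z := by
      rintro ⟨w, rfl⟩
      exact hz w.norm_lt_one
    simp [extendZero, Function.extend_apply' _ _ _ h]

theorem extendZero_smul (c : ℂ) (f : 𝔻 → ℂ) (z : ℂ) :
    extendZero (c • f) z = c * extendZero f z := by
  by_cases hz : ‖z‖ < 1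
  · simp [extendZero_of_norm_lt _ hz]
  · have h : ¬ ∃ w : 𝔻, (w : ℂ) = z := by
      rintro ⟨w, rfl⟩
      exact hz w.norm_lt_one
    simp [extendZero, Function.extend_apply' _ _ _ h]

theorem extendZero_zero (z : ℂ) : extendZero 0 z = 0 := by
  have := extendZero_smul 0 0 z
  simpa using this

/-- A subordination estimate: the square mean of `g ∘ φ` over a circle is dominated by the
Poisson integral of `‖g‖²` over a larger circle. -/
theorem sqMean_comp_le {g φ : ℂ → ℂ} (hg : DifferentiableOn ℂ g (ball 0 1))
    (hφ : DifferentiableOn ℂ φ (ball 0 1)) {r ρ : ℝ} (hr0 : 0 ≤ r) (hr1 : r < 1)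
    (hρ1 : ρ < 1) (hmaps : Set.MapsTo φ (closedBall 0 r) (ball 0 ρ)) :
    Real.circleAverage (fun z => ‖g (φ z)‖ ^ 2) 0 r ≤
      (ρ + ‖φ 0‖) / (ρ - ‖φ 0‖) * Real.circleAverage (fun z => ‖g z‖ ^ 2) 0 ρ := by
  have h0 : φ 0 ∈ ball (0 : ℂ) ρ := hmaps (by simpa using hr0)
  have hρ0 : 0 < ρ := pos_of_mem_ball h0
  have hsub : closedBall (0 : ℂ) r ⊆ ball 0 1 := closedBall_subset_ball hr1
  have hsubρ : closedBall (0 : ℂ) ρ ⊆ ball 0 1 := closedBall_subset_ball hρ1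
  have hsphρ : sphere (0 : ℂ) ρ ⊆ ball 0 1 := sphere_subset_closedBall.trans hsubρ
  set u : ℂ → ℝ := fun z => ‖g z‖ ^ 2 with hu
  have hucont : ContinuousOn u (ball 0 1) := (hg.continuousOn.norm).pow 2
  have huint : CircleIntegrable u 0 ρ := circleIntegrable_of_continuousOn hucont hρ0.le hρ1
  have hucint : CircleIntegrable (fun z => (u z : ℂ)) 0 ρ :=
    circleIntegrable_of_continuousOn (Complex.continuous_ofReal.comp_continuousOn hucont)
      hρ0.le hρ1
  set H : ℂ → ℂ := fun w =>
    Real.circleAverage (fun ζ => herglotzRieszKernel 0 w ζ • (u ζ : ℂ)) 0 ρ with hH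
  have hHdiff : DifferentiableOn ℂ H (ball 0 ρ) :=
    differentiableOn_circleAverage_herglotzRieszKernel_smul hucint
  have hHre : ∀ w ∈ ball (0 : ℂ) ρ, (H w).re =
      Real.circleAverage ((Complex.re ∘ herglotzRieszKernel 0 w) • u) 0 ρ := fun w hw =>
    re_circleAverage_herglotzRieszKernel_smul huint hw
  have hkercont : ∀ w ∈ ball (0 : ℂ) ρ,
      ContinuousOn (Complex.re ∘ herglotzRieszKernel 0 w) (sphere 0 ρ) := by
    intro w hw
    have := continuousOn_herglotzRieszKernel_sphere hw
    rw [abs_of_pos hρ0] at this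
    exact Complex.continuous_re.comp_continuousOn this
  have hker0 : ∀ w ∈ ball (0 : ℂ) ρ, ∀ z ∈ sphere (0 : ℂ) ρ,
      0 ≤ (herglotzRieszKernel 0 w z).re := by
    intro w hw z hz
    have h1 := le_re_herglotzRieszKernel hz hw
    rw [mem_ball_zero_iff] at hw
    refine le_trans ?_ h1
    rw [sub_zero]
    exact div_nonneg (by linarith) (by positivity)
  -- The Poisson integral dominates `‖g‖²`.
  have hdom : ∀ w ∈ ball (0 : ℂ) ρ, u w ≤ (H w).re := by
    intro w hw
    have hd : DiffContOnCl ℂ (fun z => g z ^ 2) (ball 0 ρ) := by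
      apply DifferentiableOn.diffContOnCl
      rw [closure_ball _ hρ0.ne']
      exact (hg.mono hsubρ).pow 2
    have hP := hd.circleAverage_re_herglotzRieszKernel_smul hw
    have h1 : u w = ‖g w ^ 2‖ := by simp [hu]
    rw [h1, ← hP, hHre w hw, Real.circleAverage_def, Real.circleAverage_def, norm_smul,
      smul_eq_mul, Real.norm_of_nonneg (by positivity)]
    refine mul_le_mul_of_nonneg_left ?_ (by positivity)
    refine (intervalIntegral.norm_integral_le_integral_norm (by positivity)).trans (le_of_eq ?_)
    refine intervalIntegral.integral_congr fun θ _ => ?_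
    have hk := hker0 w hw (circleMap 0 ρ θ) (circleMap_mem_sphere 0 hρ0.le θ)
    simp [hu, abs_of_nonneg hk]
  -- The mean value property of `H ∘ φ`.
  have hHφ : DifferentiableOn ℂ (fun z => H (φ z)) (closedBall 0 r) :=
    hHdiff.comp (hφ.mono hsub) hmaps
  have hsphr : sphere (0 : ℂ) r ⊆ closedBall 0 r := sphere_subset_closedBall
  have hmv : Real.circleAverage (fun z => H (φ z)) 0 r = H (φ 0) := by
    apply DiffContOnCl.circleAverage
    rw [abs_of_nonneg hr0]
    rcases hr0.eq_or_lt with rfl | hr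
    · rw [ball_zero]
      exact ⟨differentiableOn_empty, by simp⟩
    · apply DifferentiableOn.diffContOnCl
      rwa [closure_ball _ hr.ne']
  have hintH : CircleIntegrable (fun z => H (φ z)) 0 r :=
    ContinuousOn.circleIntegrable hr0 (hHφ.continuousOn.mono hsphr)
  have hre : Real.circleAverage (fun z => (H (φ z)).re) 0 r = (H (φ 0)).re := by
    rw [← hmv]
    exact Complex.reCLM.circleAverage_comp_comm hintH
  have hgφ : ContinuousOn (fun z => u (φ z)) (closedBall 0 r) :=
    hucont.comp (hφ.continuousOn.mono hsub)
      (hmaps.mono_right (ball_subset_ball hρ1.le))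
  calc Real.circleAverage (fun z => u (φ z)) 0 r
      ≤ Real.circleAverage (fun z => (H (φ z)).re) 0 r := by
        apply Real.circleAverage_mono
        · exact ContinuousOn.circleIntegrable hr0 (hgφ.mono hsphr)
        · exact ContinuousOn.circleIntegrable hr0
            (Complex.continuous_re.comp_continuousOn (hHφ.continuousOn.mono hsphr))
        · intro z hz
          rw [abs_of_nonneg hr0] at hz
          exact hdom _ (hmaps (hsphr hz))
    _ = Real.circleAverage ((Complex.re ∘ herglotzRieszKernel 0 (φ 0)) • u) 0 ρ := by
        rw [hre, hHre _ h0]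
    _ ≤ Real.circleAverage (fun z => ((ρ + ‖φ 0‖) / (ρ - ‖φ 0‖)) • u z) 0 ρ := by
        apply Real.circleAverage_mono
        · exact ContinuousOn.circleIntegrable hρ0.le
            ((hkercont _ h0).smul (hucont.mono hsphρ))
        · have := hucont.mono hsphρ
          exact ContinuousOn.circleIntegrable hρ0.le (by fun_prop)
        · intro z hz
          rw [abs_of_pos hρ0] at hz
          have h1 := re_herglotzRieszKernel_le hz h0
          simp only [Pi.smul_apply', Function.comp_apply, smul_eq_mul]
          refine mul_le_mul_of_nonneg_right ?_ (by positivity)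
          simpa [herglotzRieszKernel_def] using h1
    _ = (ρ + ‖φ 0‖) / (ρ - ‖φ 0‖) * Real.circleAverage u 0 ρ := by
        rw [Real.circleAverage_fun_smul, smul_eq_mul]

theorem circleSqMean_nonneg (f : 𝔻 → ℂ) (r : ℝ) : 0 ≤ circleSqMean f r :=
  Real.circleAverage_nonneg_of_nonneg fun _ _ => by positivity

theorem circleSqMean_le_of_lt {f : 𝔻 → ℂ} (hf : IsHolomorphic f) {r s : ℝ} (hr : 0 ≤ r)
    (hrs : r < s) (hs : s < 1) : circleSqMean f r ≤ circleSqMean f s := by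
  have h := sqMean_comp_le (φ := id) hf differentiableOn_id hr (hrs.trans hs) hs
    (fun z hz => closedBall_subset_ball hrs hz)
  have hs0 : s ≠ 0 := by linarith
  simpa [circleSqMean, div_self hs0] using h

theorem circleSqMean_mono {f : 𝔻 → ℂ} (hf : IsHolomorphic f) {r s : ℝ} (hr : 0 ≤ r)
    (hrs : r ≤ s) (hs : s < 1) : circleSqMean f r ≤ circleSqMean f s := by
  rcases hrs.eq_or_lt with rfl | h
  · exact le_rfl
  · exact circleSqMean_le_of_lt hf hr h hs

theorem IsHolomorphic.add {f g : 𝔻 → ℂ} (hf : IsHolomorphic f) (hg : IsHolomorphic g) :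
    IsHolomorphic (f + g) :=
  (DifferentiableOn.add hf hg).congr fun z _ => extendZero_add f g z

theorem IsHolomorphic.smul {f : 𝔻 → ℂ} (c : ℂ) (hf : IsHolomorphic f) :
    IsHolomorphic (c • f) :=
  (DifferentiableOn.const_smul hf c).congr fun z _ => extendZero_smul c f z

theorem circleSqMean_add_le {f g : 𝔻 → ℂ} (hf : IsHolomorphic f) (hg : IsHolomorphic g)
    {r : ℝ} (hr : 0 ≤ r) (hr1 : r < 1) :
    circleSqMean (f + g) r ≤ 2 * circleSqMean f r + 2 * circleSqMean g r := by
  have cf : CircleIntegrable (fun z => (2 : ℝ) • ‖extendZero f z‖ ^ 2) 0 r :=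
    circleIntegrable_of_continuousOn (by have := hf.continuousOn; fun_prop) hr hr1
  have cg : CircleIntegrable (fun z => (2 : ℝ) • ‖extendZero g z‖ ^ 2) 0 r :=
    circleIntegrable_of_continuousOn (by have := hg.continuousOn; fun_prop) hr hr1
  have cfg : CircleIntegrable (fun z => ‖extendZero (f + g) z‖ ^ 2) 0 r :=
    circleIntegrable_of_continuousOn ((hf.add hg).continuousOn.norm.pow 2) hr hr1
  have h := Real.circleAverage_mono cfg (cf.add cg) fun z _ => by
    simp only [Pi.add_apply, smul_eq_mul]
    rw [extendZero_add]
    have := norm_add_le (extendZero f z) (extendZero g z)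
    nlinarith [sq_nonneg (‖extendZero f z‖ - ‖extendZero g z‖),
      norm_nonneg (extendZero f z + extendZero g z)]
  rw [Real.circleAverage_add cf cg, Real.circleAverage_fun_smul, Real.circleAverage_fun_smul] at h
  simpa [circleSqMean] using h

theorem circleSqMean_smul (c : ℂ) (f : 𝔻 → ℂ) (r : ℝ) :
    circleSqMean (c • f) r = ‖c‖ ^ 2 * circleSqMean f r := by
  simp only [circleSqMean, extendZero_smul, norm_mul, mul_pow]
  exact Real.circleAverage_fun_smul (a := ‖c‖ ^ 2)

/-- The functions of the Hardy class: holomorphic functions on the disc whose square means over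
the circles of radius `r < 1` stay bounded. -/
def hardySubmodule : Submodule ℂ (𝔻 → ℂ) where
  carrier := {f | IsHolomorphic f ∧ ∃ C : ℝ, ∀ r : ℝ, 0 < r → r < 1 → circleSqMean f r ≤ C}
  add_mem' := by
    rintro f g ⟨hf, C, hC⟩ ⟨hg, C', hC'⟩
    refine ⟨hf.add hg, 2 * C + 2 * C', fun r h0 h1 => ?_⟩
    have := circleSqMean_add_le hf hg h0.le h1
    linarith [hC r h0 h1, hC' r h0 h1]
  zero_mem' := by
    refine ⟨?_, 0, fun r _ _ => ?_⟩
    · exact (differentiableOn_const (0 : ℂ)).congr fun z _ => extendZero_zero z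
    · simp [circleSqMean, extendZero_zero, Real.circleAverage_def]
  smul_mem' := by
    rintro c f ⟨hf, C, hC⟩
    refine ⟨hf.smul c, ‖c‖ ^ 2 * C, fun r h0 h1 => ?_⟩
    rw [circleSqMean_smul]
    exact mul_le_mul_of_nonneg_left (hC r h0 h1) (by positivity)

/-- The Hardy space `H²` of the unit disc. (A type synonym, so that it does not inherit the
topology of pointwise convergence.) -/
def HardySpace : Type := hardySubmodule

namespace HardySpace

instance : AddCommGroup HardySpace := inferInstanceAs (AddCommGroup hardySubmodule)

instance : Module ℂ HardySpace := inferInstanceAs (Module ℂ hardySubmodule)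

/-- The underlying function on the disc. -/
def toFun (f : HardySpace) : 𝔻 → ℂ := (show hardySubmodule from f).1

instance : CoeFun HardySpace fun _ => 𝔻 → ℂ := ⟨toFun⟩

@[ext] theorem ext {f g : HardySpace} (h : ∀ z, f z = g z) : f = g :=
  Subtype.ext (funext h)

theorem toFun_add (f g : HardySpace) : toFun (f + g) = toFun f + toFun g := rfl

theorem toFun_smul (c : ℂ) (f : HardySpace) : toFun (c • f) = c • toFun f := rfl

theorem isHolomorphic (f : HardySpace) : IsHolomorphic f :=
  (show hardySubmodule from f).2.1

theorem bounded (f : HardySpace) :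
    ∃ C : ℝ, ∀ r : ℝ, 0 < r → r < 1 → circleSqMean f r ≤ C :=
  (show hardySubmodule from f).2.2

/-- The inner product of `H²`, conjugate linear in the first variable as everywhere in Mathlib:
the limit of `∫_0^{2π} conj (f (r e^{iθ})) * g (r e^{iθ}) dθ / 2π` as `r → 1⁻`. -/
def innerProd (f g : HardySpace) : ℂ := limUnder (𝓝[<] (1 : ℝ)) (circlePairing f g)

theorem exists_tendsto_circleSqMean (f : HardySpace) :
    ∃ L : ℝ, Tendsto (circleSqMean f) (𝓝[<] (1 : ℝ)) (𝓝 L) ∧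
      ∀ r : ℝ, 0 < r → r < 1 → circleSqMean f r ≤ L := by
  obtain ⟨C, hC⟩ := f.bounded
  have hmono : MonotoneOn (circleSqMean f) (Set.Ioo 0 1) := fun r hr s hs hrs =>
    circleSqMean_mono f.isHolomorphic hr.1.le hrs hs.2
  have hbdd : BddAbove (circleSqMean f '' Set.Ioo 0 1) := by
    refine ⟨C, ?_⟩
    rintro _ ⟨r, hr, rfl⟩
    exact hC r hr.1 hr.2
  refine ⟨_, hmono.tendsto_nhdsWithin_Ioo_left ⟨1 / 2, by norm_num⟩ hbdd, fun r h0 h1 => ?_⟩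
  exact le_csSup hbdd ⟨r, ⟨h0, h1⟩, rfl⟩

theorem eventually_mem_Ioo : ∀ᶠ r : ℝ in 𝓝[<] (1 : ℝ), r ∈ Set.Ioo (0 : ℝ) 1 :=
  Ioo_mem_nhdsLT one_pos

theorem circlePairing_integrable (f g : HardySpace) {r : ℝ} (h0 : 0 ≤ r) (h1 : r < 1) :
    CircleIntegrable (fun z => conj (extendZero f z) * extendZero g z) 0 r :=
  circleIntegrable_of_continuousOn
    ((Complex.continuous_conj.comp_continuousOn f.isHolomorphic.continuousOn).mul
      g.isHolomorphic.continuousOn) h0 h1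

theorem circlePairing_add_left (f f' g : HardySpace) {r : ℝ} (h0 : 0 ≤ r) (h1 : r < 1) :
    circlePairing (f + f' : HardySpace) g r = circlePairing f g r + circlePairing f' g r := by
  rw [circlePairing, circlePairing, circlePairing, ← Real.circleAverage_add
    (circlePairing_integrable f g h0 h1) (circlePairing_integrable f' g h0 h1)]
  congr 1
  ext z
  simp [toFun_add, extendZero_add, add_mul]

theorem circlePairing_smul_left (c : ℂ) (f g : HardySpace) (r : ℝ) :
    circlePairing (c • f : HardySpace) g r = conj c * circlePairing f g r := by
  rw [circlePairing, circlePairing, ← smul_eq_mul (conj c), ← Real.circleAverage_fun_smul]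
  congr 1
  ext z
  simp [toFun_smul, extendZero_smul, mul_assoc]

theorem circlePairing_conj (f g : HardySpace) {r : ℝ} (h0 : 0 ≤ r) (h1 : r < 1) :
    conj (circlePairing g f r) = circlePairing f g r := by
  have h := Complex.conjCLE.toContinuousLinearMap.circleAverage_comp_comm
    (circlePairing_integrable g f h0 h1)
  refine Eq.trans h.symm ?_
  rw [circlePairing]
  congr 1
  ext z
  simp [mul_comm]

theorem circlePairing_self (f : HardySpace) {r : ℝ} (h0 : 0 ≤ r) (h1 : r < 1) :
    circlePairing f f r = (circleSqMean f r : ℂ) := by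
  have hint : CircleIntegrable (fun z => ‖extendZero f z‖ ^ 2) 0 r :=
    circleIntegrable_of_continuousOn (f.isHolomorphic.continuousOn.norm.pow 2) h0 h1
  have h := Complex.ofRealCLM.circleAverage_comp_comm hint
  refine Eq.trans ?_ h
  rw [circlePairing]
  congr 1
  ext z
  simp [Complex.conj_mul']

theorem circlePairing_polarization (f g : HardySpace) {r : ℝ} (h0 : 0 ≤ r) (h1 : r < 1) :
    circlePairing f g r =
      (circleSqMean (f + g : HardySpace) r - circleSqMean (f + (-1 : ℂ) • g : HardySpace) r
        + (circleSqMean (f + (-I) • g : HardySpace) r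
          - circleSqMean (f + I • g : HardySpace) r) * I) / 4 := by
  have hadd : ∀ u v w : HardySpace, circlePairing u (v + w : HardySpace) r =
      circlePairing u v r + circlePairing u w r := by
    intro u v w
    rw [← circlePairing_conj _ _ h0 h1, circlePairing_add_left _ _ _ h0 h1, map_add,
      circlePairing_conj _ _ h0 h1, circlePairing_conj _ _ h0 h1]
  have hsmul : ∀ (c : ℂ) (u v : HardySpace), circlePairing u (c • v : HardySpace) r =
      c * circlePairing u v r := by
    intro c u v
    rw [← circlePairing_conj _ _ h0 h1, circlePairing_smul_left, map_mul,
      circlePairing_conj _ _ h0 h1, Complex.conj_conj]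
  simp only [← circlePairing_self _ h0 h1, hadd, hsmul, circlePairing_add_left _ _ _ h0 h1,
    circlePairing_smul_left, map_neg, map_one, Complex.conj_I]
  ring_nf
  simp only [Complex.I_sq]
  ring_nf

/-- The limit defining the inner product exists. -/
theorem tendsto_circlePairing (f g : HardySpace) :
    Tendsto (circlePairing f g) (𝓝[<] (1 : ℝ)) (𝓝 (innerProd f g)) := by
  refine tendsto_nhds_limUnder ?_
  obtain ⟨a, ha, -⟩ := exists_tendsto_circleSqMean (f + g)
  obtain ⟨b, hb, -⟩ := exists_tendsto_circleSqMean (f + (-1 : ℂ) • g)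
  obtain ⟨c, hc, -⟩ := exists_tendsto_circleSqMean (f + (-I) • g)
  obtain ⟨d, hd, -⟩ := exists_tendsto_circleSqMean (f + I • g)
  refine ⟨((a : ℂ) - b + (c - d) * I) / 4, ?_⟩
  have key := (((ha.ofReal).sub (hb.ofReal)).add
    (((hc.ofReal).sub (hd.ofReal)).mul_const I)).div_const (4 : ℂ)
  refine key.congr' ?_
  filter_upwards [eventually_mem_Ioo] with r hr
  exact (circlePairing_polarization f g hr.1.le hr.2).symm

theorem innerProd_self (f : HardySpace) : ∃ L : ℝ, innerProd f f = L ∧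
    ∀ r : ℝ, 0 < r → r < 1 → circleSqMean f r ≤ L := by
  obtain ⟨L, hL, hle⟩ := exists_tendsto_circleSqMean f
  refine ⟨L, tendsto_nhds_unique (tendsto_circlePairing f f) ?_, hle⟩
  refine (hL.ofReal).congr' ?_
  filter_upwards [eventually_mem_Ioo] with r hr
  exact (circlePairing_self f hr.1.le hr.2).symm

theorem eq_zero_of_circleSqMean (f : HardySpace)
    (h : ∀ r : ℝ, 0 < r → r < 1 → circleSqMean f r ≤ 0) : f = 0 := by
  have key : ∀ r : ℝ, 0 < r → r < 1 → ∀ w ∈ ball (0 : ℂ) r, extendZero f w = 0 := by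
    intro r h0 h1 w hw
    have hw1 : ball (0 : ℂ) r ⊆ ball 0 1 := ball_subset_ball h1.le
    have hsub := sqMean_comp_le (φ := fun _ => w) f.isHolomorphic
      (differentiableOn_const w) le_rfl one_pos h1 (fun _ _ => hw)
    have hwr : ‖w‖ < r := by simpa using hw
    have hm : Real.circleAverage (fun z => ‖extendZero f z‖ ^ 2) 0 r ≤ 0 := h r h0 h1
    rw [Real.circleAverage_zero] at hsub
    have hnn : 0 ≤ (r + ‖w‖) / (r - ‖w‖) :=
      div_nonneg (by positivity) (by linarith)
    have : ‖extendZero f w‖ ^ 2 ≤ 0 := hsub.trans (mul_nonpos_of_nonneg_of_nonpos hnn hm)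
    have h2 : ‖extendZero f w‖ ^ 2 = 0 := le_antisymm this (by positivity)
    simpa using h2
  ext z
  obtain ⟨r, hr, hr1⟩ := exists_between z.norm_lt_one
  have := key r ((norm_nonneg _).trans_lt hr) hr1 z (by simpa using hr)
  rw [extendZero_coe] at this
  exact this

/-- The inner product space structure of `H²`. -/
abbrev core : InnerProductSpace.Core ℂ HardySpace where
  inner := innerProd
  conj_inner_symm f g := by
    refine tendsto_nhds_unique
      ((Complex.continuous_conj.tendsto _).comp (tendsto_circlePairing g f)) ?_
    refine (tendsto_circlePairing f g).congr' ?_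
    filter_upwards [eventually_mem_Ioo] with r hr
    exact (circlePairing_conj f g hr.1.le hr.2).symm
  re_inner_nonneg f := by
    obtain ⟨L, hL, hle⟩ := innerProd_self f
    rw [hL]
    exact (circleSqMean_nonneg f (1 / 2)).trans (hle _ (by norm_num) (by norm_num))
  add_left f g h := by
    refine tendsto_nhds_unique (tendsto_circlePairing (f + g) h) ?_
    refine ((tendsto_circlePairing f h).add (tendsto_circlePairing g h)).congr' ?_
    filter_upwards [eventually_mem_Ioo] with r hr
    exact (circlePairing_add_left f g h hr.1.le hr.2).symm
  smul_left f g c := by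
    refine tendsto_nhds_unique (tendsto_circlePairing (c • f) g) ?_
    refine ((tendsto_circlePairing f g).const_mul (conj c)).congr fun r => ?_
    exact (circlePairing_smul_left c f g r).symm
  definite f hf := by
    obtain ⟨L, hL, hle⟩ := innerProd_self f
    have h0 : L = 0 := by
      have : (L : ℂ) = 0 := hL.symm.trans hf
      exact_mod_cast this
    exact eq_zero_of_circleSqMean f fun r h1 h2 => h0 ▸ hle r h1 h2

instance : NormedAddCommGroup HardySpace := core.toNormedAddCommGroup

instance : InnerProductSpace ℂ HardySpace := InnerProductSpace.ofCore core.toCore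

theorem inner_def (f g : HardySpace) : inner ℂ f g = innerProd f g := rfl

theorem circleSqMean_le_norm_sq (f : HardySpace) {r : ℝ} (h0 : 0 < r) (h1 : r < 1) :
    circleSqMean f r ≤ ‖f‖ ^ 2 := by
  obtain ⟨L, hL, hle⟩ := innerProd_self f
  have h := InnerProductSpace.norm_sq_eq_re_inner (𝕜 := ℂ) f
  rw [inner_def, hL] at h
  have h2 : L = ‖f‖ ^ 2 := h.symm
  exact h2 ▸ hle r h0 h1

theorem norm_sq_le (f : HardySpace) {C : ℝ}
    (hC : ∀ r : ℝ, 0 < r → r < 1 → circleSqMean f r ≤ C) : ‖f‖ ^ 2 ≤ C := by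
  obtain ⟨L, hL, -⟩ := exists_tendsto_circleSqMean f
  have h1 : Tendsto (circlePairing f f) (𝓝[<] (1 : ℝ)) (𝓝 (L : ℂ)) := by
    refine (hL.ofReal).congr' ?_
    filter_upwards [eventually_mem_Ioo] with r hr
    exact (circlePairing_self f hr.1.le hr.2).symm
  have h := InnerProductSpace.norm_sq_eq_re_inner (𝕜 := ℂ) f
  rw [inner_def, tendsto_nhds_unique (tendsto_circlePairing f f) h1] at h
  have h2 : L = ‖f‖ ^ 2 := h.symm
  rw [← h2]
  refine le_of_tendsto hL ?_
  filter_upwards [eventually_mem_Ioo] with r hr using hC r hr.1 hr.2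

end HardySpace

/-- Composition with a holomorphic self-map of the disc preserves the Hardy class. -/
theorem circleSqMean_comp_le (φ : 𝔻 → 𝔻) (hφ : IsHolomorphic fun z => (φ z : ℂ))
    (f : HardySpace) {r : ℝ} (h0 : 0 < r) (h1 : r < 1) :
    circleSqMean (HardySpace.toFun f ∘ φ) r ≤
      (1 + ‖(φ 0 : ℂ)‖) / (1 - ‖(φ 0 : ℂ)‖) * ‖f‖ ^ 2 := by
  set Φ : ℂ → ℂ := extendZero fun z => (φ z : ℂ) with hΦ
  have hΦ0 : Φ 0 = (φ 0 : ℂ) := extendZero_coe _ (0 : 𝔻)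
  have hb : ‖(φ 0 : ℂ)‖ < 1 := (φ 0).norm_lt_one
  have hsub : closedBall (0 : ℂ) r ⊆ ball 0 1 := closedBall_subset_ball h1
  -- `Φ` maps the closed disc of radius `r` into a smaller disc.
  obtain ⟨σ, hσ1, hσ⟩ : ∃ σ < 1, ∀ z ∈ closedBall (0 : ℂ) r, ‖Φ z‖ ≤ σ := by
    obtain ⟨z₀, hz₀, hmax⟩ := (isCompact_closedBall (0 : ℂ) r).exists_isMaxOn
      ⟨0, by simpa using h0.le⟩ (hφ.continuousOn.mono hsub).norm
    refine ⟨‖Φ z₀‖, ?_, fun z hz => hmax hz⟩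
    have hz1 : ‖z₀‖ < 1 := by simpa using hsub hz₀
    rw [hΦ, extendZero_of_norm_lt _ hz1]
    exact (φ _).norm_lt_one
  have hcongr : circleSqMean (HardySpace.toFun f ∘ φ) r =
      Real.circleAverage (fun z => ‖extendZero f (Φ z)‖ ^ 2) 0 r := by
    refine Real.circleAverage_congr_sphere fun z hz => ?_
    rw [abs_of_pos h0, mem_sphere_zero_iff_norm] at hz
    have hz1 : ‖z‖ < 1 := by linarith
    simp [hΦ, extendZero_of_norm_lt _ hz1]
  have hest : ∀ᶠ ρ : ℝ in 𝓝[<] (1 : ℝ), circleSqMean (HardySpace.toFun f ∘ φ) r ≤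
      (ρ + ‖(φ 0 : ℂ)‖) / (ρ - ‖(φ 0 : ℂ)‖) * ‖f‖ ^ 2 := by
    filter_upwards [HardySpace.eventually_mem_Ioo, Ioo_mem_nhdsLT hσ1] with ρ hρ hρσ
    have hmaps : Set.MapsTo Φ (closedBall 0 r) (ball 0 ρ) := fun z hz => by
      rw [mem_ball_zero_iff]
      exact (hσ z hz).trans_lt hρσ.1
    have h := sqMean_comp_le f.isHolomorphic hφ h0.le h1 hρ.2 hmaps
    rw [hcongr]
    have hlt : ‖Φ 0‖ < ρ := by simpa using hmaps (show (0 : ℂ) ∈ closedBall 0 r by simpa using h0.le)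
    refine h.trans ?_
    rw [show (extendZero fun z => (φ z : ℂ)) 0 = (φ 0 : ℂ) from hΦ0]
    rw [hΦ0] at hlt
    refine mul_le_mul_of_nonneg_left (f.circleSqMean_le_norm_sq hρ.1 hρ.2) ?_
    exact div_nonneg (by linarith [norm_nonneg (φ 0 : ℂ)]) (by linarith)
  refine ge_of_tendsto ?_ hest
  have hne : (1 : ℝ) - ‖(φ 0 : ℂ)‖ ≠ 0 := by linarith
  have hc : ContinuousAt (fun ρ : ℝ => (ρ + ‖(φ 0 : ℂ)‖) / (ρ - ‖(φ 0 : ℂ)‖) * ‖f‖ ^ 2) 1 :=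
    (ContinuousAt.div (continuousAt_id.add continuousAt_const)
      (continuousAt_id.sub continuousAt_const) hne).mul continuousAt_const
  exact hc.tendsto.mono_left nhdsWithin_le_nhds

/-- The composition operator `C_φ f = f ∘ φ` on `H²`, a bounded operator for every holomorphic
self-map `φ` of the disc. -/
def compositionOperator (φ : 𝔻 → 𝔻) (hφ : IsHolomorphic fun z => (φ z : ℂ)) :
    HardySpace →L[ℂ] HardySpace :=
  LinearMap.mkContinuousOfExistsBound
    { toFun := fun f => ⟨HardySpace.toFun f ∘ φ, f.isHolomorphic.comp hφ,
        (1 + ‖(φ 0 : ℂ)‖) / (1 - ‖(φ 0 : ℂ)‖) * ‖f‖ ^ 2,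
        fun _ h0 h1 => circleSqMean_comp_le φ hφ f h0 h1⟩
      map_add' := fun _ _ => rfl
      map_smul' := fun _ _ => rfl }
    (by
      refine ⟨√((1 + ‖(φ 0 : ℂ)‖) / (1 - ‖(φ 0 : ℂ)‖)), fun f => ?_⟩
      have hb : ‖(φ 0 : ℂ)‖ < 1 := (φ 0).norm_lt_one
      have hnn : 0 ≤ (1 + ‖(φ 0 : ℂ)‖) / (1 - ‖(φ 0 : ℂ)‖) :=
        div_nonneg (by positivity) (by linarith)
      refine abs_le_of_sq_le_sq' ?_ (by positivity) |>.2
      rw [mul_pow, Real.sq_sqrt hnn]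
      exact HardySpace.norm_sq_le _ fun r h0 h1 => circleSqMean_comp_le φ hφ f h0 h1)

@[simp] theorem compositionOperator_apply (φ : 𝔻 → 𝔻) (hφ : IsHolomorphic fun z => (φ z : ℂ))
    (f : HardySpace) (z : 𝔻) : compositionOperator φ hφ f z = f (φ z) := rfl

/-- The numerical range `W(T) = {⟨T f, f⟩ : ‖f‖ = 1}` of an operator. Mathlib's `inner ℂ f (T f)`
is linear in `T f`, so it is the usual `⟨T f, f⟩`. -/
def numericalRange {H : Type*} [NormedAddCommGroup H] [InnerProductSpace ℂ H] (T : H →L[ℂ] H) :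
    Set ℂ :=
  {w | ∃ f : H, ‖f‖ = 1 ∧ inner ℂ f (T f) = w}

/-- The group of (conformal) automorphisms of the disc: bijections of the disc onto itself that
are holomorphic together with their inverse. -/
def discAut : Subgroup (Equiv.Perm 𝔻) where
  carrier := {φ | IsHolomorphic (fun z => (φ z : ℂ)) ∧ IsHolomorphic (fun z => (φ⁻¹ z : ℂ))}
  mul_mem' := by
    rintro φ ψ ⟨h1, h2⟩ ⟨h3, h4⟩
    refine ⟨h1.comp h3, ?_⟩
    rw [mul_inv_rev]
    exact h4.comp h2
  one_mem' := by
    have : IsHolomorphic fun z : 𝔻 => (z : ℂ) := by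
      refine differentiableOn_id.congr fun z hz => ?_
      rw [mem_ball_zero_iff] at hz
      simp [extendZero_of_norm_lt _ hz]
    exact ⟨this, this⟩
  inv_mem' := by
    rintro φ ⟨h1, h2⟩
    exact ⟨h2, by simpa using h1⟩

/-- An automorphism of the disc is elliptic if it is not the identity and has a fixed point in
the (open) disc. -/
def IsElliptic (φ : discAut) : Prop := φ ≠ 1 ∧ ∃ a : 𝔻, (φ : Equiv.Perm 𝔻) a = a

/-- The operator `C_φ` on `H²` of an automorphism `φ` of the disc. -/
def autCompositionOperator (φ : discAut) : HardySpace →L[ℂ] HardySpace :=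
  compositionOperator (φ : Equiv.Perm 𝔻) φ.2.1

/-- The open ellipse (interior of the ellipse) with foci `p`, `q` and semi-major axis `s`. -/
def openEllipse (p q : ℂ) (s : ℝ) : Set ℂ := {w | dist w p + dist w q < 2 * s}

end HardyDisc

end

/-! Let `b = φ 0` and `κ = ‖b‖`. An involutive automorphism with a fixed point `a ≠ 0` is the Möbius
involution exchanging `0` and `b`, and the fixed point equation gives `κ = 2‖a‖ / (1 + ‖a‖²)`. So `1
- κ²` is the inverse square of the claimed semi-major axis, and only `κ` matters from then on.

`T = C_φ` satisfies `T² = 1`. Split `f = g + h` with `T g = g`, `T h = -h`. Then `⟨T f, f⟩` has real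
part `‖g‖² - ‖h‖²`, and its imaginary part is `2 Im ⟨g, h⟩` up to sign. Hence the numerical range
depends only on the possible cosines `|⟨g, h⟩| / (‖g‖ ‖h‖)` between the two eigenspaces. If these
stay strictly below `κ` and come arbitrarily close to it, the range is exactly the open ellipse
(`numericalRange_involution_subset`, `subset_numericalRange_involution`). The cosines are controlled
by the norm of `T`: the two conditions follow from `‖T‖² = (1 + κ) / (1 - κ)` with the norm not
attained.

For the norm, `f ↦ √(1 - κ²) · (f ∘ φ) / (1 - conj b z)` is an isometry
(`norm_mulKernel_autCompositionOperator`). Writing `f = u - conj b · S u`, with `S` the shift, this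
yields `‖T f‖² = (1 - κ²) ‖u‖²`. Since `conj b = κ η` with `|η| = 1` and `η S` is an isometry, `‖f‖
≥ (1 - κ) ‖u‖`. Equality would need an eigenvector of the shift, and there is none; geometric sums
are approximate eigenvectors. -/

noncomputable section

namespace HardyDisc

/-! ### Geometry of the ellipse -/

/-- Cartesian description of an ellipse with foci `1`, `-1`, in terms of its eccentricity `√(1-κ²)`. -/
theorem mem_openEllipse_one_neg_one_iff {κ s : ℝ} (hκ0 : 0 < κ) (hκ1 : κ < 1) (hs0 : 0 < s)
    (hs : s ^ 2 * (1 - κ ^ 2) = 1) (w : ℂ) :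
    w ∈ openEllipse 1 (-1) s ↔ (1 - κ ^ 2) * (κ ^ 2 * w.re ^ 2 + w.im ^ 2) < κ ^ 2 := by
  have hκ2 : 0 < 1 - κ ^ 2 := by nlinarith
  have hs1 : 1 < s ^ 2 := by nlinarith [sq_nonneg (s * κ), mul_pos hs0 hκ0]
  have hκs : κ ^ 2 * s ^ 2 = s ^ 2 - 1 := by linarith
  have hA : dist w 1 ^ 2 = (w.re - 1) ^ 2 + w.im ^ 2 := by
    rw [Complex.dist_eq, Complex.sq_norm, Complex.normSq_apply]
    simp; ring
  have hB : dist w (-1) ^ 2 = (w.re + 1) ^ 2 + w.im ^ 2 := by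
    rw [Complex.dist_eq, Complex.sq_norm, Complex.normSq_apply]
    simp; ring
  have hA0 : 0 ≤ dist w 1 := dist_nonneg
  have hB0 : 0 ≤ dist w (-1) := dist_nonneg
  change dist w 1 + dist w (-1) < 2 * s ↔ _
  generalize dist w 1 = A at *
  generalize dist w (-1) = B at *
  generalize w.re = x at *
  generalize w.im = y at *
  -- Multiplying by `s⁴` clears `κ` and leaves the equation with semi-axes `s` and `√(s² - 1)`.
  have h1 : (1 - κ ^ 2) * (κ ^ 2 * x ^ 2 + y ^ 2) < κ ^ 2 ↔
      (s ^ 2 - 1) * x ^ 2 + s ^ 2 * y ^ 2 < s ^ 2 * (s ^ 2 - 1) := by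
    have hs4 : 0 < s ^ 4 := by positivity
    rw [← mul_lt_mul_iff_right₀ hs4]
    have e1 : s ^ 4 * ((1 - κ ^ 2) * (κ ^ 2 * x ^ 2 + y ^ 2)) =
        (s ^ 2 - 1) * x ^ 2 + s ^ 2 * y ^ 2 := by
      linear_combination (κ ^ 2 * s ^ 2 * x ^ 2 + s ^ 2 * y ^ 2) * hs + x ^ 2 * hκs
    have e2 : s ^ 4 * κ ^ 2 = s ^ 2 * (s ^ 2 - 1) := by linear_combination s ^ 2 * hκs
    rw [e1, e2]
  rw [h1]
  -- The radicals are removed by squaring twice: first `A + B`, then the product `A * B` left over.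
  have hAB : (A * B) ^ 2 = (x ^ 2 + y ^ 2 + 1) ^ 2 - 4 * x ^ 2 := by
    rw [mul_pow, hA, hB]; ring
  have hsum : (A + B) ^ 2 = 2 * (x ^ 2 + y ^ 2 + 1) + 2 * (A * B) := by
    linear_combination hA + hB
  have hABnn : 0 ≤ A * B := mul_nonneg hA0 hB0
  constructor
  · intro h
    have h2 : (A + B) ^ 2 < (2 * s) ^ 2 := by
      apply pow_lt_pow_left₀ h (by positivity) two_ne_zero
    have h3 : A * B < 2 * s ^ 2 - (x ^ 2 + y ^ 2 + 1) := by linarith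
    have h4 := pow_lt_pow_left₀ h3 hABnn two_ne_zero
    rw [hAB] at h4
    linarith
  · intro h
    -- The bounds `x² < s²` and `y² < s² - 1` make `2s² - (x² + y² + 1)` positive, which is what
    -- permits undoing the second squaring.
    have hy : s ^ 2 * y ^ 2 < s ^ 2 * (s ^ 2 - 1) := by nlinarith [sq_nonneg x]
    have hx : (s ^ 2 - 1) * x ^ 2 < (s ^ 2 - 1) * s ^ 2 := by nlinarith [sq_nonneg y]
    have hy' := lt_of_mul_lt_mul_left hy (by positivity)
    have hx' := lt_of_mul_lt_mul_left hx (by linarith)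
    have h3 : A * B < 2 * s ^ 2 - (x ^ 2 + y ^ 2 + 1) := by
      apply lt_of_pow_lt_pow_left₀ 2 (by linarith)
      rw [hAB]
      linarith
    have h2 : (A + B) ^ 2 < (2 * s) ^ 2 := by linarith
    exact lt_of_pow_lt_pow_left₀ 2 (by positivity) h2

theorem isOpen_openEllipse (p q : ℂ) (s : ℝ) : IsOpen (openEllipse p q s) :=
  isOpen_lt (by fun_prop) (by fun_prop)

/-- Here `P` plays the role of `‖g‖² + ‖h‖²` for eigencomponents whose cosine is `k`, and `x + iy`
is the value to be realised. The equation is solved by the intermediate value theorem. -/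
theorem exists_sq_sub_sq_eq {δ k x y : ℝ} (hδ0 : 0 < δ) (hδ1 : δ < 1) (hkδ : δ < k)
    (hδw : (1 - δ ^ 2) * (δ ^ 2 * x ^ 2 + y ^ 2) < δ ^ 2) :
    ∃ P, |x| ≤ P ∧ k ^ 2 * (P ^ 2 - x ^ 2) = (1 - P) ^ 2 + y ^ 2 := by
  set e : ℝ := 1 - δ ^ 2 with he
  have he0 : 0 < e := by nlinarith
  have he1 : e ≤ 1 := by nlinarith
  have hx : x ^ 2 < 1 / e := by
    rw [lt_div_iff₀ he0]
    have : δ ^ 2 * (x ^ 2 * e) < δ ^ 2 * 1 := by nlinarith only [mul_nonneg he0.le (sq_nonneg y), hδw]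
    exact lt_of_mul_lt_mul_left this (by positivity)
  have hone : 1 ≤ 1 / e := by rw [le_div_iff₀ he0]; linarith
  have hxP : |x| ≤ 1 / e := by
    apply abs_le_of_sq_le_sq _ (by positivity)
    have : 1 / e ≤ (1 / e) ^ 2 := le_self_pow₀ hone two_ne_zero
    linarith
  -- At `P = |x|` the difference is nonpositive. The other endpoint `1 / e` maximises `δ² P² - (1 -
  -- P)²`; the maximum `δ² / e` is exactly what the ellipse inequality needs.
  have hcont : ContinuousOn (fun P : ℝ => k ^ 2 * (P ^ 2 - x ^ 2) - ((1 - P) ^ 2 + y ^ 2))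
      (Set.Icc |x| (1 / e)) := by fun_prop
  have hmem : (0 : ℝ) ∈ Set.Icc (k ^ 2 * (|x| ^ 2 - x ^ 2) - ((1 - |x|) ^ 2 + y ^ 2))
      (k ^ 2 * ((1 / e) ^ 2 - x ^ 2) - ((1 - 1 / e) ^ 2 + y ^ 2)) := by
    constructor
    · rw [sq_abs, sub_self, mul_zero]
      linarith [sq_nonneg (1 - |x|), sq_nonneg y]
    · have h1 : 0 ≤ (1 / e) ^ 2 - x ^ 2 := by
        have : 1 / e ≤ (1 / e) ^ 2 := le_self_pow₀ hone two_ne_zero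
        linarith
      have h2 : δ ^ 2 * ((1 / e) ^ 2 - x ^ 2) ≤ k ^ 2 * ((1 / e) ^ 2 - x ^ 2) := by gcongr
      have h3 : δ ^ 2 * x ^ 2 + y ^ 2 < δ ^ 2 / e := by
        rw [lt_div_iff₀ he0]; linarith
      have h4 : δ ^ 2 * (1 / e) ^ 2 - (1 - 1 / e) ^ 2 = δ ^ 2 / e := by
        have : δ ^ 2 = 1 - e := by rw [he]; ring
        rw [this]; field_simp; ring
      linarith
  obtain ⟨P, hP, hP0⟩ := intermediate_value_Icc hxP hcont hmem
  exact ⟨P, hP.1, by simp only at hP0; linarith⟩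

/-! ### Numerical range of an involution on an inner product space -/

section Involution

variable {H : Type*} [NormedAddCommGroup H] [InnerProductSpace ℂ H]

/-- For `T g = g` and `T h = -h` this is the quadratic form of `T` at `g + h`. The real part of
`inner ℂ g h` drops out and enters only through the normalisation of `g + h`. -/
theorem inner_add_sub_eigenvectors (g h : H) :
    inner ℂ (g + h) (g - h) =
      ((‖g‖ ^ 2 - ‖h‖ ^ 2 : ℝ) : ℂ) - ((2 * (inner ℂ g h).im : ℝ) : ℂ) * I := by
  simp only [inner_add_left, inner_sub_right]
  have hre : (inner ℂ h g : ℂ).re = (inner ℂ g h : ℂ).re := inner_re_symm (𝕜 := ℂ) h g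
  have him : (inner ℂ h g : ℂ).im = -(inner ℂ g h : ℂ).im := inner_im_symm (𝕜 := ℂ) h g
  rw [inner_self_eq_norm_sq_to_K, inner_self_eq_norm_sq_to_K]
  apply Complex.ext <;> simp [← Complex.ofReal_pow, hre, him] <;> ring

/-- If the norm of an involution is `√((1 + κ) / (1 - κ))` and is not attained, then any two
eigenvectors for `1` and `-1` make an angle with cosine less than `κ`. -/
theorem norm_inner_lt_of_norm_involution_lt {T : H →L[ℂ] H} {κ : ℝ}
    (hT : ∀ f, f ≠ 0 → (1 - κ) * ‖T f‖ ^ 2 < (1 + κ) * ‖f‖ ^ 2)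
    {g h : H} (hg : T g = g) (hh : T h = -h) (hg0 : g ≠ 0) (hh0 : h ≠ 0) :
    ‖(inner ℂ g h : ℂ)‖ < κ * (‖g‖ * ‖h‖) := by
  have hgp : 0 < ‖g‖ := norm_pos_iff.2 hg0
  have hhp : 0 < ‖h‖ := norm_pos_iff.2 hh0
  set c : ℂ := inner ℂ g h with hc
  -- The quotient `‖T f‖ / ‖f‖` is largest on the span of `g` and `h` when both components have
  -- equal norm and negative real inner product; `u` fixes the phase and `t` also the length.
  obtain ⟨u, hu, huc⟩ : ∃ u : ℂ, ‖u‖ = 1 ∧ u * c = -(‖c‖ : ℂ) := by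
    by_cases h0 : c = 0
    · exact ⟨1, by simp, by simp [h0]⟩
    · have hn : (‖c‖ : ℂ) ≠ 0 := by simpa using h0
      refine ⟨-(conj c / ‖c‖), by simp [h0], ?_⟩
      rw [neg_mul, div_mul_eq_mul_div, Complex.conj_mul', sq, mul_div_assoc, div_self hn, mul_one]
  set t : ℂ := (‖g‖ / ‖h‖ : ℝ) * u with ht
  have htn : ‖t • h‖ = ‖g‖ := by
    rw [norm_smul, ht, norm_mul, hu, Complex.norm_real, Real.norm_of_nonneg (by positivity)]
    field_simp
  have hin : (inner ℂ g (t • h) : ℂ).re = -(‖g‖ / ‖h‖ * ‖c‖) := by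
    rw [inner_smul_right, ← hc, ht, mul_assoc, huc, ← Complex.ofReal_neg, ← Complex.ofReal_mul,
      Complex.ofReal_re]
    ring
  have hadd := norm_add_sq (𝕜 := ℂ) g (t • h)
  have hsub := norm_sub_sq (𝕜 := ℂ) g (t • h)
  have hre : RCLike.re (inner ℂ g (t • h) : ℂ) = -(‖g‖ / ‖h‖ * ‖c‖) := hin
  rw [htn, hre] at hadd hsub
  have hTf : T (g + t • h) = g - t • h := by rw [map_add, map_smul, hg, hh, smul_neg, sub_eq_add_neg]
  have hne : g + t • h ≠ 0 := by
    intro h0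
    rw [h0, map_zero] at hTf
    have h2 : (2 : ℂ) • g = 0 := by
      rw [two_smul, ← add_zero (g + g)]
      have : g + g = (g + t • h) + (g - t • h) := by abel
      rw [this, h0, ← hTf]; simp
    exact hg0 (by simpa using h2)
  have key := hT _ hne
  rw [hTf, hadd, hsub] at key
  have hr : ‖g‖ / ‖h‖ * ‖c‖ < κ * ‖g‖ ^ 2 := by linarith
  have := mul_lt_mul_of_pos_right hr (div_pos hhp hgp)
  have e1 : ‖g‖ / ‖h‖ * ‖c‖ * (‖h‖ / ‖g‖) = ‖c‖ := by field_simp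
  have e2 : κ * ‖g‖ ^ 2 * (‖h‖ / ‖g‖) = κ * (‖g‖ * ‖h‖) := by field_simp
  rwa [e1, e2] at this

/-- The numerical range of an involution whose norm is `√((1 + κ) / (1 - κ))` and is not attained
is contained in an open ellipse. -/
theorem numericalRange_involution_subset {T : H →L[ℂ] H} {κ : ℝ} (hκ0 : 0 < κ) (hκ1 : κ < 1)
    (hinv : ∀ f, T (T f) = f)
    (hT : ∀ f, f ≠ 0 → (1 - κ) * ‖T f‖ ^ 2 < (1 + κ) * ‖f‖ ^ 2) {w : ℂ}
    (hw : w ∈ numericalRange T) :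
    (1 - κ ^ 2) * (κ ^ 2 * w.re ^ 2 + w.im ^ 2) < κ ^ 2 := by
  obtain ⟨f, hf, rfl⟩ := hw
  -- The projections `(1 ± T) / 2` onto the two eigenspaces.
  set g : H := (1 / 2 : ℂ) • (f + T f) with hg
  set h : H := (1 / 2 : ℂ) • (f - T f) with hh
  have hTg : T g = g := by rw [hg, map_smul, map_add, hinv, add_comm]
  have hTh : T h = -h := by rw [hh, map_smul, map_sub, hinv, ← smul_neg, neg_sub]
  have hsum : f = g + h := by
    rw [hg, hh, ← smul_add, show f + T f + (f - T f) = (2 : ℂ) • f by rw [two_smul]; abel,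
      smul_smul]
    norm_num
  have hTf : T f = g - h := by rw [hsum, map_add, hTg, hTh, sub_eq_add_neg]
  have hnorm : (1 : ℝ) = ‖g‖ ^ 2 + 2 * (inner ℂ g h : ℂ).re + ‖h‖ ^ 2 := by
    have := norm_add_sq (𝕜 := ℂ) g h
    rw [← hsum, hf, one_pow] at this
    exact this
  have hsq : (inner ℂ g h : ℂ).re ^ 2 + (inner ℂ g h : ℂ).im ^ 2 = ‖(inner ℂ g h : ℂ)‖ ^ 2 := by
    rw [Complex.sq_norm, Complex.normSq_apply]; ring
  have hin : inner ℂ f (T f) = ((‖g‖ ^ 2 - ‖h‖ ^ 2 : ℝ) : ℂ)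
      - ((2 * (inner ℂ g h : ℂ).im : ℝ) : ℂ) * I := by
    rw [hTf, ← inner_add_sub_eigenvectors, ← hsum]
  rw [hin]
  simp only [Complex.sub_re, Complex.sub_im, Complex.ofReal_re, Complex.ofReal_im,
    Complex.re_ofReal_mul, Complex.im_ofReal_mul, Complex.I_re, Complex.I_im]
  have hκ2 : 0 < 1 - κ ^ 2 := by nlinarith
  by_cases h0 : g = 0 ∨ h = 0
  -- Here `f` itself is an eigenvector and the value is a focus `±1`.
  · have hc : (inner ℂ g h : ℂ) = 0 := by
      rcases h0 with h0 | h0 <;> simp [h0]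
    have hpq : (‖g‖ ^ 2 - ‖h‖ ^ 2) ^ 2 = 1 := by
      rw [hc] at hnorm
      have h2 : ‖g‖ ^ 2 * ‖h‖ ^ 2 = 0 := by rcases h0 with h0 | h0 <;> simp [h0]
      rw [Complex.zero_re] at hnorm
      linear_combination -4 * h2 - (1 + ‖g‖ ^ 2 + ‖h‖ ^ 2) * hnorm
    rw [hc]
    simp only [Complex.zero_im, mul_zero, sub_zero, hpq]
    nlinarith [mul_pos hκ0 hκ0]
  · push Not at h0
    have hlt := norm_inner_lt_of_norm_involution_lt hT hTg hTh h0.1 h0.2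
    have hlt2 := pow_lt_pow_left₀ hlt (norm_nonneg _) two_ne_zero
    rw [← hsq] at hlt2
    generalize (inner ℂ g h : ℂ).re = x at *
    generalize (inner ℂ g h : ℂ).im = y at *
    generalize ‖g‖ = p at *
    generalize ‖h‖ = q at *
    have hc1 := mul_lt_mul_of_pos_left hlt2 hκ2
    have hp : p ^ 2 + q ^ 2 = 1 - 2 * x := by linarith
    have hpq : p ^ 2 * q ^ 2 * 4 = (1 - 2 * x) ^ 2 - (p ^ 2 - q ^ 2) ^ 2 := by
      rw [← hp]; ring
    have hpq2 : (κ * (p * q)) ^ 2 * 4 = κ ^ 2 * ((1 - 2 * x) ^ 2 - (p ^ 2 - q ^ 2) ^ 2) := by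
      rw [← hpq]; ring
    -- After the cosine bound is inserted and `p² + q²` is replaced by `1 - 2x`, the remaining slack
    -- in the ellipse inequality is this square.
    have := sq_nonneg (κ ^ 2 * (1 - 2 * x) + 2 * x)
    linear_combination 4 * hc1 + this + (1 - κ ^ 2) * hpq2

/-- Rescaling `g` and `h` and rotating one of them produces any norms `p`, `q` and any inner product
of modulus `k p q`. A unit vector with value `x + iy` needs `p² - q² = x` and inner product `((1 -
P) - iy) / 2`, where `P = p² + q²`; `hP` says that this number has the right modulus. -/
theorem mem_numericalRange_of_eigenvectors {T : H →L[ℂ] H} {g h : H} (hTg : T g = g)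
    (hTh : T h = -h) (hg0 : g ≠ 0) (hh0 : h ≠ 0) (hc0 : (inner ℂ g h : ℂ) ≠ 0) {P x y : ℝ}
    (hPx : |x| ≤ P)
    (hP : (‖(inner ℂ g h : ℂ)‖ / (‖g‖ * ‖h‖)) ^ 2 * (P ^ 2 - x ^ 2) = (1 - P) ^ 2 + y ^ 2) :
    (⟨x, y⟩ : ℂ) ∈ numericalRange T := by
  set c : ℂ := inner ℂ g h with hc
  have hcpos : 0 < ‖c‖ := norm_pos_iff.2 hc0
  have hgp : 0 < ‖g‖ := norm_pos_iff.2 hg0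
  have hhp : 0 < ‖h‖ := norm_pos_iff.2 hh0
  set k : ℝ := ‖c‖ / (‖g‖ * ‖h‖) with hk
  have hk0 : 0 < k := by positivity
  have hp : 0 ≤ (P + x) / 2 := by linarith [neg_abs_le x]
  have hq : 0 ≤ (P - x) / 2 := by linarith [le_abs_self x]
  set p : ℝ := √((P + x) / 2)
  set q : ℝ := √((P - x) / 2)
  have hp2 : p ^ 2 = (P + x) / 2 := Real.sq_sqrt hp
  have hq2 : q ^ 2 = (P - x) / 2 := Real.sq_sqrt hq
  have hp0 : 0 ≤ p := Real.sqrt_nonneg _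
  have hq0 : 0 ≤ q := Real.sqrt_nonneg _
  set d : ℂ := ⟨(1 - P) / 2, -(y / 2)⟩ with hd
  have hdn : ‖d‖ = k * (p * q) := by
    have : ‖d‖ ^ 2 = (k * (p * q)) ^ 2 := by
      rw [Complex.sq_norm, Complex.normSq_apply, mul_pow, mul_pow, hp2, hq2]
      simp only [hd]
      linear_combination -hP / 4
    exact (pow_left_inj₀ (norm_nonneg _) (by positivity) two_ne_zero).1 this
  obtain ⟨v, hv, hvd⟩ : ∃ v : ℂ, ‖v‖ = 1 ∧ ((p / ‖g‖ : ℝ) * ((q / ‖h‖ : ℝ) * v)) * c = d := by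
    -- If a component vanishes then `d = 0`, so any phase will do.
    by_cases hpq : p * q = 0
    · refine ⟨1, by simp, ?_⟩
      rw [hpq, mul_zero, norm_eq_zero] at hdn
      rw [hdn]
      rcases mul_eq_zero.1 hpq with h0 | h0 <;> simp [h0]
    · have hm : ((p / ‖g‖ : ℝ) * ((q / ‖h‖ : ℝ)) * c : ℂ) ≠ 0 := by
        have h1 : p ≠ 0 := left_ne_zero_of_mul hpq
        have h2 : q ≠ 0 := right_ne_zero_of_mul hpq
        refine mul_ne_zero (mul_ne_zero ?_ ?_) hc0
        · exact_mod_cast div_ne_zero h1 hgp.ne'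
        · exact_mod_cast div_ne_zero h2 hhp.ne'
      refine ⟨d / ((p / ‖g‖ : ℝ) * ((q / ‖h‖ : ℝ)) * c), ?_, ?_⟩
      · rw [norm_div, hdn, norm_mul, norm_mul, Complex.norm_real, Complex.norm_real,
          Real.norm_of_nonneg (by positivity), Real.norm_of_nonneg (by positivity), hk]
        rw [div_eq_one_iff_eq (by
          rw [div_mul_div_comm]
          exact mul_ne_zero (div_ne_zero hpq (by positivity)) hcpos.ne')]
        field_simp
      · rw [← mul_assoc, mul_right_comm, mul_div_cancel₀ _ hm]
  set G : H := ((p / ‖g‖ : ℝ) : ℂ) • g with hG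
  set K : H := (((q / ‖h‖ : ℝ) : ℂ) * v) • h with hK
  have hGn : ‖G‖ = p := by
    rw [hG, norm_smul, Complex.norm_real, Real.norm_of_nonneg (by positivity)]
    field_simp
  have hKn : ‖K‖ = q := by
    rw [hK, norm_smul, norm_mul, hv, Complex.norm_real, Real.norm_of_nonneg (by positivity)]
    field_simp
  have hGK : inner ℂ G K = d := by
    rw [hG, hK, inner_smul_left, inner_smul_right, Complex.conj_ofReal, ← hvd, ← hc]
    ring
  have hTG : T (G + K) = G - K := by
    rw [hG, hK, map_add, map_smul, map_smul, hTg, hTh, smul_neg, sub_eq_add_neg]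
  refine ⟨G + K, ?_, ?_⟩
  · have := norm_add_sq (𝕜 := ℂ) G K
    rw [hGK, hGn, hKn, hp2, hq2] at this
    have h1 : RCLike.re d = (1 - P) / 2 := rfl
    rw [h1] at this
    have h2 : ‖G + K‖ ^ 2 = 1 := by linarith
    exact (pow_eq_one_iff_of_nonneg (norm_nonneg _) two_ne_zero).1 h2
  · rw [hTG, inner_add_sub_eigenvectors, hGK, hGn, hKn, hp2, hq2]
    apply Complex.ext <;> simp [hd] <;> ring

/-- The numerical range of an involution whose norm is at least `√((1 + κ) / (1 - κ))` contains
an open ellipse. -/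
theorem subset_numericalRange_involution {T : H →L[ℂ] H} {κ : ℝ} (hκ0 : 0 < κ) (hκ1 : κ < 1)
    (hinv : ∀ f, T (T f) = f)
    (hT : ∀ δ, 0 < δ → δ < κ → ∃ f, f ≠ 0 ∧ (1 + δ) * ‖f‖ ^ 2 < (1 - δ) * ‖T f‖ ^ 2) {w : ℂ}
    (hw : (1 - κ ^ 2) * (κ ^ 2 * w.re ^ 2 + w.im ^ 2) < κ ^ 2) :
    w ∈ numericalRange T := by
  -- The cosine `κ` is only approached. The inequality for `w` is strict and continuous in `κ`, so
  -- it survives for some `δ < κ`.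
  obtain ⟨δ, hδ0, hδκ, hδw⟩ : ∃ δ, 0 < δ ∧ δ < κ ∧
      (1 - δ ^ 2) * (δ ^ 2 * w.re ^ 2 + w.im ^ 2) < δ ^ 2 := by
    have hc : ∀ᶠ δ : ℝ in 𝓝[<] κ, (1 - δ ^ 2) * (δ ^ 2 * w.re ^ 2 + w.im ^ 2) < δ ^ 2 := by
      apply Filter.Eventually.filter_mono nhdsWithin_le_nhds
      exact ContinuousAt.eventually_lt (by fun_prop) (by fun_prop) hw
    obtain ⟨δ, h1, h2⟩ := (hc.and (Ioo_mem_nhdsLT hκ0)).exists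
    exact ⟨δ, h2.1, h2.2, h1⟩
  have hδ1 : δ < 1 := hδκ.trans hκ1
  obtain ⟨f, hf0, hf⟩ := hT δ hδ0 hδκ
  set g : H := (1 / 2 : ℂ) • (f + T f) with hg
  set h : H := (1 / 2 : ℂ) • (f - T f) with hh
  have hTg : T g = g := by rw [hg, map_smul, map_add, hinv, add_comm]
  have hTh : T h = -h := by rw [hh, map_smul, map_sub, hinv, ← smul_neg, neg_sub]
  have hsum : f = g + h := by
    rw [hg, hh, ← smul_add, show f + T f + (f - T f) = (2 : ℂ) • f by rw [two_smul]; abel,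
      smul_smul]
    norm_num
  have hTf : T f = g - h := by rw [hsum, map_add, hTg, hTh, sub_eq_add_neg]
  have hadd := norm_add_sq (𝕜 := ℂ) g h
  have hsub := norm_sub_sq (𝕜 := ℂ) g h
  rw [← hsum] at hadd
  rw [hTf, hsub, hadd] at hf
  have hre : δ * (‖g‖ ^ 2 + ‖h‖ ^ 2) < 2 * -RCLike.re (inner ℂ g h : ℂ) := by linarith
  have hcn : -RCLike.re (inner ℂ g h : ℂ) ≤ ‖(inner ℂ g h : ℂ)‖ :=
    (neg_le_abs _).trans (RCLike.abs_re_le_norm _)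
  set c : ℂ := inner ℂ g h with hc
  -- Arithmetic-geometric mean: `2 ‖g‖ ‖h‖ ≤ ‖g‖² + ‖h‖²`.
  have hlow : δ * (‖g‖ * ‖h‖) < ‖c‖ := by nlinarith [sq_nonneg (‖g‖ - ‖h‖)]
  have hcpos : 0 < ‖c‖ := lt_of_le_of_lt (by positivity) hlow
  have hc0 : c ≠ 0 := norm_pos_iff.1 hcpos
  have hg0 : g ≠ 0 := by rintro h0; exact hc0 (by rw [hc, h0, inner_zero_left])
  have hh0 : h ≠ 0 := by rintro h0; exact hc0 (by rw [hc, h0, inner_zero_right])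
  have hgp : 0 < ‖g‖ := norm_pos_iff.2 hg0
  have hhp : 0 < ‖h‖ := norm_pos_iff.2 hh0
  set k : ℝ := ‖c‖ / (‖g‖ * ‖h‖) with hk
  have hkδ : δ < k := by rw [hk, lt_div_iff₀ (by positivity)]; exact hlow
  obtain ⟨x, y⟩ := w
  simp only at hδw
  obtain ⟨P, hPx, hP⟩ := exists_sq_sub_sq_eq hδ0 hδ1 hkδ hδw
  exact mem_numericalRange_of_eigenvectors hTg hTh hg0 hh0 hc0 hPx hP

end Involution

/-! ### Involutive automorphisms of the disc -/

theorem one_sub_conj_mul_ne_zero {b z : ℂ} (hb : ‖b‖ < 1) (hz : ‖z‖ ≤ 1) : 1 - conj b * z ≠ 0 := by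
  intro h
  have h1 : ‖conj b * z‖ < 1 := by
    rw [norm_mul, RCLike.norm_conj]
    nlinarith [norm_nonneg b, norm_nonneg z]
  rw [← sub_eq_zero.1 h] at h1
  simp at h1

theorem sq_norm_one_sub_conj_mul_sub (b z : ℂ) :
    ‖1 - conj b * z‖ ^ 2 - ‖b - z‖ ^ 2 = (1 - ‖b‖ ^ 2) * (1 - ‖z‖ ^ 2) := by
  simp only [Complex.sq_norm, Complex.normSq_apply]
  simp
  ring

theorem norm_moebius_lt_one {b z : ℂ} (hb : ‖b‖ < 1) (hz : ‖z‖ < 1) :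
    ‖(b - z) / (1 - conj b * z)‖ < 1 := by
  have h0 := norm_pos_iff.2 (one_sub_conj_mul_ne_zero hb hz.le)
  rw [norm_div, div_lt_one h0]
  apply lt_of_pow_lt_pow_left₀ 2 h0.le
  have := sq_norm_one_sub_conj_mul_sub b z
  have h1 : 0 < 1 - ‖b‖ ^ 2 := by nlinarith [norm_nonneg b]
  have h2 : 0 < 1 - ‖z‖ ^ 2 := by nlinarith [norm_nonneg z]
  nlinarith [mul_pos h1 h2]

theorem moebius_moebius {b z : ℂ} (hb : ‖b‖ < 1) (hz : ‖z‖ < 1) :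
    (b - (b - z) / (1 - conj b * z)) / (1 - conj b * ((b - z) / (1 - conj b * z))) = z := by
  have h0 := one_sub_conj_mul_ne_zero hb hz.le
  have h1 := one_sub_conj_mul_ne_zero hb (norm_moebius_lt_one hb hz).le
  rw [div_eq_iff h1]
  have h2 : (1 - conj b * z) * ((b - z) / (1 - conj b * z)) = b - z := mul_div_cancel₀ _ h0
  linear_combination -h2

theorem isHolomorphic_moebius {b : ℂ} (hb : ‖b‖ < 1) {φ : 𝔻 → 𝔻}
    (hφ : ∀ z, (φ z : ℂ) = (b - z) / (1 - conj b * z)) : IsHolomorphic fun z => (φ z : ℂ) := by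
  have : DifferentiableOn ℂ (fun z : ℂ => (b - z) / (1 - conj b * z)) (ball 0 1) := by
    refine DifferentiableOn.div (by fun_prop) (by fun_prop) fun z hz => ?_
    exact one_sub_conj_mul_ne_zero hb (mem_ball_zero_iff.1 hz).le
  refine this.congr fun z hz => ?_
  rw [extendZero_of_norm_lt _ (mem_ball_zero_iff.1 hz), hφ]
  rfl

/-- The involutive automorphism of the disc exchanging `0` and `b`. -/
def moebius (b : 𝔻) : discAut :=
  have hinv : Function.Involutive fun z : 𝔻 =>
      UnitDisc.mk ((b - z) / (1 - conj (b : ℂ) * z))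
        (norm_moebius_lt_one b.norm_lt_one z.norm_lt_one) := fun z => by
    apply UnitDisc.coe_injective
    simp only [UnitDisc.coe_mk]
    exact moebius_moebius b.norm_lt_one z.norm_lt_one
  ⟨hinv.toPerm, isHolomorphic_moebius b.norm_lt_one fun _ => rfl,
    isHolomorphic_moebius b.norm_lt_one fun _ => rfl⟩

theorem coe_moebius (b z : 𝔻) :
    ((moebius b : Equiv.Perm 𝔻) z : ℂ) = (b - z) / (1 - conj (b : ℂ) * z) := rfl

theorem moebius_self (b : 𝔻) : (moebius b : Equiv.Perm 𝔻) b = 0 := by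
  apply UnitDisc.coe_injective
  rw [coe_moebius]
  simp

theorem moebius_zero (b : 𝔻) : (moebius b : Equiv.Perm 𝔻) 0 = b := by
  apply UnitDisc.coe_injective
  rw [coe_moebius]
  simp

theorem moebius_mul_self (b : 𝔻) : moebius b * moebius b = 1 := by
  ext z
  exact moebius_moebius b.norm_lt_one z.norm_lt_one

/-- The Schwarz lemma for self-maps of the disc. -/
theorem norm_le_of_isHolomorphic {φ : 𝔻 → 𝔻} (hφ : IsHolomorphic fun z => (φ z : ℂ))
    (h0 : φ 0 = 0) (z : 𝔻) : ‖(φ z : ℂ)‖ ≤ ‖(z : ℂ)‖ := by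
  have := Complex.norm_le_norm_of_mapsTo_ball (E := ℂ) (F := ℂ) (z := z) hφ (fun w hw => ?_) ?_
    z.norm_lt_one
  · rwa [extendZero_coe] at this
  · rw [extendZero_of_norm_lt _ (mem_ball_zero_iff.1 hw), mem_closedBall_zero_iff]
    exact (φ _).norm_lt_one.le
  · have := extendZero_coe (fun z => (φ z : ℂ)) 0
    rw [UnitDisc.coe_zero] at this
    rw [this, h0, UnitDisc.coe_zero]

/-- An automorphism of the disc which fixes the origin is a rotation. -/
theorem discAut_eq_rotation (φ : discAut) (h0 : (φ : Equiv.Perm 𝔻) 0 = 0) :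
    ∃ c : ℂ, ∀ z, ((φ : Equiv.Perm 𝔻) z : ℂ) = c * z := by
  set F : ℂ → ℂ := extendZero fun z => ((φ : Equiv.Perm 𝔻) z : ℂ) with hF
  have hF0 : F 0 = 0 := by
    have := extendZero_coe (fun z => ((φ : Equiv.Perm 𝔻) z : ℂ)) 0
    rwa [h0, UnitDisc.coe_zero] at this
  have h0' : (φ : Equiv.Perm 𝔻)⁻¹ 0 = 0 := by rw [Equiv.Perm.inv_eq_iff_eq, h0]
  -- The Schwarz lemma for both `φ` and its inverse gives equality; equality at the single point `1
  -- / 2` then forces linearity.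
  have hnorm : ∀ z, ‖((φ : Equiv.Perm 𝔻) z : ℂ)‖ = ‖(z : ℂ)‖ := fun z => by
    refine le_antisymm (norm_le_of_isHolomorphic φ.2.1 h0 z) ?_
    have := norm_le_of_isHolomorphic φ.2.2 h0' ((φ : Equiv.Perm 𝔻) z)
    simpa using this
  have hmaps : Set.MapsTo F (ball 0 1) (closedBall (F 0) 1) := fun w hw => by
    rw [hF0, mem_closedBall_zero_iff, hF, extendZero_of_norm_lt _ (mem_ball_zero_iff.1 hw)]
    exact ((φ : Equiv.Perm 𝔻) _).norm_lt_one.le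
  have hhalf : ‖(1 / 2 : ℂ)‖ < 1 := by norm_num
  obtain ⟨c, -, hc⟩ := Complex.affine_of_mapsTo_ball_of_exists_norm_dslope_eq_div' φ.2.1 hmaps
    ⟨1 / 2, by rwa [mem_ball_zero_iff], by
      rw [dslope_of_ne _ (by norm_num), slope_def_module, norm_smul, ← hF, hF0, sub_zero, sub_zero, hF,
        extendZero_of_norm_lt _ hhalf, hnorm]
      norm_num⟩
  refine ⟨c, fun z => ?_⟩
  have := hc (mem_ball_zero_iff.2 z.norm_lt_one)
  simp only [extendZero_coe] at this
  rw [this, ← hF, hF0]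
  simp [mul_comm]

/-- An automorphism of the disc of order `2` with a fixed point other than the origin is the
involution exchanging `0` and some point of the disc. -/
theorem eq_moebius_of_orderOf_eq_two (φ : discAut) (hord : orderOf φ = 2) {a : 𝔻}
    (hfix : (φ : Equiv.Perm 𝔻) a = a) (ha : a ≠ 0) :
    φ = moebius ((φ : Equiv.Perm 𝔻) 0) := by
  have h2 : φ * φ = 1 := by rw [← sq, ← hord, pow_orderOf_eq_one]
  have h1 : φ ≠ 1 := by rintro rfl; simp at hord
  set b : 𝔻 := (φ : Equiv.Perm 𝔻) 0 with hb
  have hφb : (φ : Equiv.Perm 𝔻) b = 0 := by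
    have : ((φ * φ : discAut) : Equiv.Perm 𝔻) 0 = 0 := by rw [h2]; rfl
    exact this
  -- A rotation with a nonzero fixed point is the identity.
  have rot1 : ∀ ψ : discAut, ∀ w : 𝔻, w ≠ 0 → (ψ : Equiv.Perm 𝔻) 0 = 0 →
      (ψ : Equiv.Perm 𝔻) w = w → ψ = 1 := by
    intro ψ w hw h0 hψ
    obtain ⟨c, hc⟩ := discAut_eq_rotation ψ h0
    have hw' : (w : ℂ) ≠ 0 := by simpa using hw
    have : c = 1 := by
      have := hc w
      rw [hψ] at this
      exact mul_right_cancel₀ hw' (by rw [one_mul, ← this])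
    ext z
    rw [hc, this, one_mul]
    rfl
  have hb0 : b ≠ 0 := fun h0 => h1 (rot1 φ a ha h0 hfix)
  -- Both factors exchange `0` and `b`, so the product fixes both points.
  have key : moebius b * φ = 1 := by
    refine rot1 _ b hb0 ?_ ?_
    · change (moebius b : Equiv.Perm 𝔻) b = 0
      exact moebius_self b
    · change (moebius b : Equiv.Perm 𝔻) ((φ : Equiv.Perm 𝔻) b) = b
      rw [hφb, moebius_zero]
  calc φ = moebius b * (moebius b * φ) := by rw [← mul_assoc, moebius_mul_self, one_mul]
    _ = moebius b := by rw [key, mul_one]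

/-- The fixed point of the involution exchanging `0` and `b` determines `‖b‖`. -/
theorem norm_of_moebius_fixed {a b : 𝔻} (hfix : (moebius b : Equiv.Perm 𝔻) a = a) (ha : a ≠ 0) :
    ‖(b : ℂ)‖ = 2 * ‖(a : ℂ)‖ / (1 + ‖(a : ℂ)‖ ^ 2) := by
  have ha' : (a : ℂ) ≠ 0 := by simpa using ha
  have hfix' : ((b : ℂ) - a) / (1 - conj (b : ℂ) * a) = a := by rw [← coe_moebius, hfix]
  rw [div_eq_iff (one_sub_conj_mul_ne_zero b.norm_lt_one a.norm_lt_one.le)] at hfix'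
  -- In terms of `t` the fixed point equation becomes `t + ‖a‖² conj t = 2`, which forces `t` to be
  -- real because `‖a‖ < 1`.
  set t : ℂ := b / a with ht
  have hbt : (b : ℂ) = a * t := by rw [ht]; field_simp
  have hn : (a : ℂ) * conj (a : ℂ) = ((‖(a : ℂ)‖ ^ 2 : ℝ) : ℂ) := by
    rw [Complex.mul_conj']; push_cast; ring
  have h1 : t + conj t * ((‖(a : ℂ)‖ ^ 2 : ℝ) : ℂ) = 2 := by
    rw [hbt, map_mul] at hfix'
    apply mul_left_cancel₀ ha'
    rw [← hn]
    linear_combination hfix'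
  have hre := congrArg Complex.re h1
  have him := congrArg Complex.im h1
  simp only [Complex.add_re, Complex.add_im, Complex.re_mul_ofReal, Complex.im_mul_ofReal,
    Complex.conj_re, Complex.conj_im, Complex.re_ofNat, Complex.im_ofNat] at hre him
  have hlt := a.sq_norm_lt_one
  have him0 : t.im = 0 := by
    have : t.im * (1 - ‖(a : ℂ)‖ ^ 2) = 0 := by linarith
    rcases mul_eq_zero.1 this with h | h
    · exact h
    · linarith
  have hpos : 0 < 1 + ‖(a : ℂ)‖ ^ 2 := by positivity
  have htre : t.re = 2 / (1 + ‖(a : ℂ)‖ ^ 2) := by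
    rw [eq_div_iff hpos.ne']; linarith
  have ht' : t = ((2 / (1 + ‖(a : ℂ)‖ ^ 2) : ℝ) : ℂ) := Complex.ext htre him0
  rw [hbt, ht', norm_mul, Complex.norm_real, Real.norm_of_nonneg (by positivity)]
  ring

/-! ### Multiplication by bounded holomorphic functions -/

theorem extendZero_fun_mul (m f : 𝔻 → ℂ) (z : ℂ) :
    extendZero (fun z => m z * f z) z = extendZero m z * extendZero f z := by
  by_cases hz : ‖z‖ < 1
  · simp [extendZero_of_norm_lt _ hz]
  · have h : ¬ ∃ w : 𝔻, (w : ℂ) = z := by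
      rintro ⟨w, rfl⟩
      exact hz w.norm_lt_one
    simp [extendZero, Function.extend_apply' _ _ _ h]

theorem IsHolomorphic.fun_mul {m f : 𝔻 → ℂ} (hm : IsHolomorphic m) (hf : IsHolomorphic f) :
    IsHolomorphic fun z => m z * f z :=
  (DifferentiableOn.mul hm hf).congr fun z _ => extendZero_fun_mul m f z

theorem isHolomorphic_of_differentiableOn {F : ℂ → ℂ} (hF : DifferentiableOn ℂ F (ball 0 1)) :
    IsHolomorphic fun z => F z :=
  hF.congr fun z hz => by rw [extendZero_of_norm_lt _ (mem_ball_zero_iff.1 hz)]; rfl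

theorem circleSqMean_fun_mul_le {m f : 𝔻 → ℂ} (hm : IsHolomorphic m) (hf : IsHolomorphic f)
    {C : ℝ} (hC : ∀ z, ‖m z‖ ≤ C) {r : ℝ} (h0 : 0 ≤ r) (h1 : r < 1) :
    circleSqMean (fun z => m z * f z) r ≤ C ^ 2 * circleSqMean f r := by
  rw [circleSqMean, circleSqMean, ← smul_eq_mul, ← Real.circleAverage_fun_smul]
  apply Real.circleAverage_mono
  · exact circleIntegrable_of_continuousOn ((hm.fun_mul hf).continuousOn.norm.pow 2) h0 h1
  · exact circleIntegrable_of_continuousOn 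
      (by have := hf.continuousOn; fun_prop) h0 h1
  · intro z hz
    rw [abs_of_nonneg h0, mem_sphere_zero_iff_norm] at hz
    have hz1 : ‖z‖ < 1 := by linarith
    rw [extendZero_fun_mul, norm_mul, mul_pow, smul_eq_mul]
    have : ‖extendZero m z‖ ≤ C := by rw [extendZero_of_norm_lt _ hz1]; exact hC _
    gcongr

namespace HardySpace

/-- The product of a bounded holomorphic function with a function in the Hardy space. -/
def mul (m : 𝔻 → ℂ) (hm : IsHolomorphic m) {C : ℝ} (hC : ∀ z, ‖m z‖ ≤ C) (f : HardySpace) :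
    HardySpace :=
  ⟨fun z => m z * f z, hm.fun_mul f.isHolomorphic, C ^ 2 * ‖f‖ ^ 2, fun _ h0 h1 =>
    (circleSqMean_fun_mul_le hm f.isHolomorphic hC h0.le h1).trans
      (mul_le_mul_of_nonneg_left (f.circleSqMean_le_norm_sq h0 h1) (sq_nonneg C))⟩

theorem sub_apply (f g : HardySpace) (z : 𝔻) : (f - g) z = f z - g z := rfl

theorem smul_apply (c : ℂ) (f : HardySpace) (z : 𝔻) : (c • f) z = c * f z := rfl

theorem zero_apply (z : 𝔻) : (0 : HardySpace) z = 0 := rfl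

theorem tendsto_circleSqMean (f : HardySpace) :
    Tendsto (circleSqMean f) (𝓝[<] (1 : ℝ)) (𝓝 (‖f‖ ^ 2)) := by
  obtain ⟨L, hL, -⟩ := exists_tendsto_circleSqMean f
  have h1 : ‖f‖ ^ 2 ≤ L := norm_sq_le f fun r h0 h1 => by
    obtain ⟨L', hL', hle⟩ := exists_tendsto_circleSqMean f
    rw [tendsto_nhds_unique hL hL']
    exact hle r h0 h1
  have h2 : L ≤ ‖f‖ ^ 2 := by
    refine le_of_tendsto hL ?_
    filter_upwards [eventually_mem_Ioo] with r hr using f.circleSqMean_le_norm_sq hr.1 hr.2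
  rwa [le_antisymm h1 h2]

/-- The constant function `1`. -/
def one : HardySpace :=
  ⟨fun _ => 1, isHolomorphic_of_differentiableOn (F := fun _ => 1) (by fun_prop), 1,
    fun r h0 h1 => by
      refine (le_of_eq ?_ : _ ≤ Real.circleAverage (fun _ => (1 : ℝ)) 0 r).trans
        (Real.circleAverage_const _ _ _).le
      refine Real.circleAverage_congr_sphere fun z hz => ?_
      rw [abs_of_pos h0, mem_sphere_zero_iff_norm] at hz
      simp [extendZero_of_norm_lt (fun _ => (1 : ℂ)) (hz.trans_lt h1)]⟩

theorem one_apply (z : 𝔻) : one z = 1 := rfl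

theorem norm_one : ‖one‖ = 1 := by
  have h : ‖one‖ ^ 2 = 1 := by
    refine tendsto_nhds_unique one.tendsto_circleSqMean (tendsto_const_nhds.congr' ?_)
    filter_upwards [eventually_mem_Ioo] with r hr
    symm
    refine Eq.trans ?_ (Real.circleAverage_const (1 : ℝ) 0 r)
    refine Real.circleAverage_congr_sphere fun z hz => ?_
    rw [abs_of_pos hr.1, mem_sphere_zero_iff_norm] at hz
    simp [extendZero_of_norm_lt _ (hz.trans_lt hr.2), one_apply]
  exact (pow_eq_one_iff_of_nonneg (norm_nonneg _) two_ne_zero).1 h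

/-! ### The shift and its approximate eigenvectors -/

/-- The shift, that is multiplication by the coordinate. -/
def shift (f : HardySpace) : HardySpace :=
  mul (fun z => z) (isHolomorphic_of_differentiableOn differentiableOn_id)
    (fun z => z.norm_lt_one.le) f

theorem shift_apply (f : HardySpace) (z : 𝔻) : shift f z = z * f z := rfl

theorem shift_sub (f g : HardySpace) : shift (f - g) = shift f - shift g := by
  ext z
  simp only [shift_apply, sub_apply]
  ring

/-- The square mean over the circle of radius `r` is multiplied by `r²`, which tends to `1`. -/
theorem norm_shift (f : HardySpace) : ‖shift f‖ = ‖f‖ := by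
  have h : ‖shift f‖ ^ 2 = 1 ^ 2 * ‖f‖ ^ 2 := by
    refine tendsto_nhds_unique (shift f).tendsto_circleSqMean (Tendsto.congr' ?_
      (((tendsto_id.mono_left nhdsWithin_le_nhds).pow 2).mul f.tendsto_circleSqMean))
    filter_upwards [eventually_mem_Ioo] with r hr
    rw [id, circleSqMean, circleSqMean, ← smul_eq_mul, ← Real.circleAverage_fun_smul]
    refine Real.circleAverage_congr_sphere fun z hz => ?_
    rw [abs_of_pos hr.1, mem_sphere_zero_iff_norm] at hz
    have hz1 := hz.trans_lt hr.2
    simp [extendZero_of_norm_lt _ hz1, shift_apply, mul_pow, hz]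
  rw [one_pow, one_mul] at h
  exact (pow_left_inj₀ (norm_nonneg _) (norm_nonneg _) two_ne_zero).1 h

/-- Pairing with `1` is the mean value over circles, hence the value at `0`. -/
theorem inner_one_shift (f : HardySpace) : inner ℂ one (shift f) = 0 := by
  rw [inner_def]
  refine tendsto_nhds_unique (tendsto_circlePairing _ _) (tendsto_const_nhds.congr' ?_)
  filter_upwards [eventually_mem_Ioo] with r hr
  have hd : DiffContOnCl ℂ (extendZero (shift f)) (ball 0 |r|) := by
    apply DifferentiableOn.diffContOnCl
    rw [abs_of_pos hr.1, closure_ball _ hr.1.ne']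
    exact (shift f).isHolomorphic.mono (closedBall_subset_ball hr.2)
  have h0 : extendZero (shift f) 0 = 0 := by
    rw [extendZero_of_norm_lt _ (by simp), shift_apply, UnitDisc.coe_mk, zero_mul]
  rw [← h0, ← hd.circleAverage, circlePairing]
  refine Real.circleAverage_congr_sphere fun z hz => ?_
  rw [abs_of_pos hr.1, mem_sphere_zero_iff_norm] at hz
  simp [extendZero_of_norm_lt one (hz.trans_lt hr.2), one_apply]

/-- The geometric sums `∑_{k < n} (η z) ^ k`. -/
def geomSum (η : ℂ) : ℕ → HardySpace
  | 0 => 0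
  | n + 1 => one + η • shift (geomSum η n)

/-- Pythagoras: `one` is orthogonal to the range of the isometry `η • shift`, so each recursion step
adds `1`. -/
theorem norm_geomSum_sq {η : ℂ} (hη : ‖η‖ = 1) (n : ℕ) : ‖geomSum η n‖ ^ 2 = n := by
  induction n with
  | zero => simp [geomSum]
  | succ n ih =>
    rw [geomSum, norm_add_sq (𝕜 := ℂ), inner_smul_right, inner_one_shift, norm_smul, hη, norm_shift,
      one_mul, ih, norm_one]
    simp [add_comm]

theorem norm_geomSum_succ_sub {η : ℂ} (hη : ‖η‖ = 1) (n : ℕ) :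
    ‖geomSum η (n + 1) - geomSum η n‖ = 1 := by
  induction n with
  | zero =>
    have : shift 0 = 0 := by ext z; simp [shift_apply, zero_apply]
    simp [geomSum, this, norm_one]
  | succ n ih =>
    have : geomSum η (n + 1 + 1) - geomSum η (n + 1) =
        η • shift (geomSum η (n + 1) - geomSum η n) := by
      rw [shift_sub, smul_sub, geomSum, geomSum, add_sub_add_left_eq_sub]
    rw [this, norm_smul, hη, norm_shift, ih, one_mul]

/-- `η • shift` moves the `n`-th sum by a vector of norm at most `2` (the next monomial minus
`one`), small against the norm `√n` of the sum. -/
theorem norm_geomSum_sub_smul_shift_le {η : ℂ} (hη : ‖η‖ = 1) {κ : ℝ} (h0 : 0 ≤ κ) (h1 : κ ≤ 1)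
    (n : ℕ) : ‖geomSum η n - ((κ : ℂ) * η) • shift (geomSum η n)‖ ≤ (1 - κ) * √n + 2 * κ := by
  have hn : ‖geomSum η n‖ = √n := by
    rw [← norm_geomSum_sq hη, Real.sqrt_sq (norm_nonneg _)]
  have hsucc : geomSum η (n + 1) = one + η • shift (geomSum η n) := rfl
  have hsplit : geomSum η n - ((κ : ℂ) * η) • shift (geomSum η n) =
      ((1 - κ : ℝ) : ℂ) • geomSum η n - (κ : ℂ) • (geomSum η (n + 1) - geomSum η n - one) := by
    rw [hsucc, mul_smul]
    push_cast
    module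
  rw [hsplit]
  refine (norm_sub_le _ _).trans ?_
  rw [norm_smul, norm_smul, Complex.norm_real, Complex.norm_real, hn,
    Real.norm_of_nonneg (by linarith), Real.norm_of_nonneg h0]
  have := norm_sub_le (geomSum η (n + 1) - geomSum η n) one
  rw [norm_geomSum_succ_sub hη, norm_one] at this
  nlinarith

/-- Otherwise `‖u‖² ≤ Re ⟨u, η S u⟩`; as `η S` is isometric, this is the equality case of
Cauchy–Schwarz and `η S u = u`. Then `(1 - η z) u = 0`, so `u = 0`. This is why the norm of `C_φ` is
not attained. -/
theorem lt_norm_sub_smul_shift {u : HardySpace} (hu : u ≠ 0) {η : ℂ} (hη : ‖η‖ = 1) {κ : ℝ}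
    (h0 : 0 < κ) : (1 - κ) * ‖u‖ < ‖u - ((κ : ℂ) * η) • shift u‖ := by
  by_contra! hle
  have hle2 := pow_le_pow_left₀ (norm_nonneg _) hle 2
  rw [mul_smul, norm_sub_sq (𝕜 := ℂ), inner_smul_right, norm_smul, Complex.norm_real,
    Real.norm_of_nonneg h0.le, norm_smul, hη, norm_shift] at hle2
  have hre : RCLike.re ((κ : ℂ) * inner ℂ u (η • shift u)) =
      κ * RCLike.re (inner ℂ u (η • shift u)) := Complex.re_ofReal_mul _ _
  rw [hre] at hle2
  have hge : ‖u‖ ^ 2 ≤ RCLike.re (inner ℂ u (η • shift u) : ℂ) := by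
    have : κ * ‖u‖ ^ 2 ≤ κ * RCLike.re (inner ℂ u (η • shift u) : ℂ) := by linarith
    exact le_of_mul_le_mul_left this h0
  have hsub := norm_sub_sq (𝕜 := ℂ) u (η • shift u)
  rw [norm_smul, hη, norm_shift, one_mul] at hsub
  have hz : ‖u - η • shift u‖ ^ 2 = 0 := le_antisymm (by linarith) (sq_nonneg _)
  have heq : u - η • shift u = 0 := by simpa using hz
  refine hu (ext fun z => ?_)
  have hpt : (1 - η * z) * u z = 0 := by
    have : (u - η • shift u) z = 0 := by rw [heq, zero_apply]
    rw [sub_apply, smul_apply, shift_apply] at this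
    linear_combination this
  rcases mul_eq_zero.1 hpt with h | h
  · have : ‖η * z‖ < 1 := by rw [norm_mul, hη, one_mul]; exact z.norm_lt_one
    rw [← sub_eq_zero.1 h] at this
    simp at this
  · rw [h, zero_apply]

end HardySpace

/-! ### A weighted subordination estimate -/

theorem continuousOn_poissonKernel_sphere {w : ℂ} {R : ℝ} (hw : w ∈ ball (0 : ℂ) R) :
    ContinuousOn (poissonKernel 0 w) (sphere 0 R) := by
  have := continuousOn_herglotzRieszKernel_sphere hw
  rw [abs_of_pos (pos_of_mem_ball hw)] at this
  rw [poissonKernel_eq_re_herglotzRieszKernel]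
  exact Complex.continuous_re.comp_continuousOn this

theorem poissonKernel_nonneg {w z : ℂ} {R : ℝ} (hw : w ∈ ball (0 : ℂ) R)
    (hz : z ∈ sphere (0 : ℂ) R) : 0 ≤ poissonKernel 0 w z := by
  rw [mem_ball_zero_iff] at hw
  rw [mem_sphere_zero_iff_norm] at hz
  rw [poissonKernel_def, sub_zero, sub_zero, hz]
  have := pow_le_pow_left₀ (norm_nonneg _) hw.le 2
  exact div_nonneg (by linarith) (sq_nonneg _)

/-- A harmonic majorant of `‖g‖ ^ 2`, with Harnack's inequality. -/
theorem exists_re_majorant {g : ℂ → ℂ} (hg : DifferentiableOn ℂ g (ball 0 1)) {ρ : ℝ}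
    (hρ0 : 0 < ρ) (hρ1 : ρ < 1) :
    ∃ H : ℂ → ℂ, DifferentiableOn ℂ H (ball 0 ρ) ∧ ∀ w ∈ ball (0 : ℂ) ρ, ‖g w‖ ^ 2 ≤ (H w).re ∧
      (H w).re ≤ (ρ + ‖w‖) / (ρ - ‖w‖) * Real.circleAverage (fun z => ‖g z‖ ^ 2) 0 ρ := by
  have hsubρ : closedBall (0 : ℂ) ρ ⊆ ball 0 1 := closedBall_subset_ball hρ1
  have hsphρ : sphere (0 : ℂ) ρ ⊆ ball 0 1 := sphere_subset_closedBall.trans hsubρ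
  set u : ℂ → ℝ := fun z => ‖g z‖ ^ 2 with hu
  have hucont : ContinuousOn u (ball 0 1) := (hg.continuousOn.norm).pow 2
  have huint : CircleIntegrable u 0 ρ := circleIntegrable_of_continuousOn hucont hρ0.le hρ1
  have hucint : CircleIntegrable (fun z => (u z : ℂ)) 0 ρ :=
    circleIntegrable_of_continuousOn (Complex.continuous_ofReal.comp_continuousOn hucont)
      hρ0.le hρ1
  -- The witness is the Herglotz–Riesz integral of `u`, whose real part is the Poisson integral of
  -- `u`.
  refine ⟨_, differentiableOn_circleAverage_herglotzRieszKernel_smul hucint, fun w hw => ?_⟩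
  rw [re_circleAverage_herglotzRieszKernel_smul huint hw, ← poissonKernel_eq_re_herglotzRieszKernel]
  constructor
  -- The Poisson integral reproduces the holomorphic function `g²`; taking norms under the integral
  -- gives the majorisation.
  · have hd : DiffContOnCl ℂ (fun z => g z ^ 2) (ball 0 ρ) := by
      apply DifferentiableOn.diffContOnCl
      rw [closure_ball _ hρ0.ne']
      exact (hg.mono hsubρ).pow 2
    have hP := hd.circleAverage_poissonKernel_smul hw
    rw [← norm_pow, ← hP, Real.circleAverage_def, Real.circleAverage_def, norm_smul,
      smul_eq_mul, Real.norm_of_nonneg (by positivity)]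
    refine mul_le_mul_of_nonneg_left ?_ (by positivity)
    refine (intervalIntegral.norm_integral_le_integral_norm (by positivity)).trans (le_of_eq ?_)
    refine intervalIntegral.integral_congr fun θ _ => ?_
    have hk := poissonKernel_nonneg hw (circleMap_mem_sphere 0 hρ0.le θ)
    simp [hu, abs_of_nonneg hk]
  · rw [← smul_eq_mul, ← Real.circleAverage_fun_smul]
    apply Real.circleAverage_mono
    · exact ContinuousOn.circleIntegrable hρ0.le
        ((continuousOn_poissonKernel_sphere hw).smul (hucont.mono hsphρ))
    · exact ContinuousOn.circleIntegrable hρ0.le 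
        (by have := hucont.mono hsphρ; fun_prop)
    · intro z hz
      rw [abs_of_pos hρ0] at hz
      have h1 := re_herglotzRieszKernel_le hz hw
      rw [poissonKernel_eq_re_herglotzRieszKernel]
      simp only [Pi.smul_apply', Function.comp_apply, smul_eq_mul]
      refine mul_le_mul_of_nonneg_right ?_ (by positivity)
      simpa [herglotzRieszKernel_def] using h1

/-- A subordination estimate, for the Poisson means of `‖g ∘ φ‖ ^ 2` with respect to an arbitrary
point `c` in the disc of radius `r`. -/
theorem circleAverage_poissonKernel_mul_sq_comp_le {g φ : ℂ → ℂ}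
    (hg : DifferentiableOn ℂ g (ball 0 1)) (hφ : DifferentiableOn ℂ φ (ball 0 1)) {r ρ : ℝ}
    (hr1 : r < 1) (hρ1 : ρ < 1) (hmaps : Set.MapsTo φ (closedBall 0 r) (ball 0 ρ)) {c : ℂ}
    (hc : c ∈ ball (0 : ℂ) r) :
    Real.circleAverage (fun z => poissonKernel 0 c z * ‖g (φ z)‖ ^ 2) 0 r ≤
      (ρ + ‖φ c‖) / (ρ - ‖φ c‖) * Real.circleAverage (fun z => ‖g z‖ ^ 2) 0 ρ := by
  have hr0 : 0 < r := pos_of_mem_ball hc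
  have hφc : φ c ∈ ball (0 : ℂ) ρ := hmaps (ball_subset_closedBall hc)
  obtain ⟨H, hH, hHb⟩ := exists_re_majorant hg (pos_of_mem_ball hφc) hρ1
  refine le_trans ?_ (hHb _ hφc).2
  have hsub : closedBall (0 : ℂ) r ⊆ ball 0 1 := closedBall_subset_ball hr1
  have hsph : sphere (0 : ℂ) r ⊆ closedBall 0 r := sphere_subset_closedBall
  have hHφ : DifferentiableOn ℂ (fun z => H (φ z)) (closedBall 0 r) :=
    hH.comp (hφ.mono hsub) hmaps
  have hd : DiffContOnCl ℂ (fun z => H (φ z)) (ball 0 r) := by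
    apply DifferentiableOn.diffContOnCl
    rwa [closure_ball _ hr0.ne']
  -- The Poisson mean at `c` of the holomorphic `H ∘ φ` is its value at `c`, so the majorant is
  -- evaluated at `φ c`.
  have hmv := hd.circleAverage_poissonKernel_smul hc
  have hk := continuousOn_poissonKernel_sphere hc
  have hint : CircleIntegrable (poissonKernel 0 c • fun z => H (φ z)) 0 r :=
    ContinuousOn.circleIntegrable hr0.le (hk.smul (hHφ.continuousOn.mono hsph))
  have hre := Complex.reCLM.circleAverage_comp_comm hint
  rw [hmv] at hre
  change _ ≤ Complex.reCLM (H (φ c))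
  rw [← hre]
  have hgφ : ContinuousOn (fun z => ‖g (φ z)‖ ^ 2) (closedBall 0 r) :=
    ((hg.continuousOn.comp (hφ.continuousOn.mono hsub)
      (hmaps.mono_right (ball_subset_ball hρ1.le))).norm).pow 2
  apply Real.circleAverage_mono
  · exact ContinuousOn.circleIntegrable hr0.le (hk.mul (hgφ.mono hsph))
  · exact ContinuousOn.circleIntegrable hr0.le (Complex.reCLM.continuous.comp_continuousOn
      (hk.smul (hHφ.continuousOn.mono hsph)))
  · intro z hz
    rw [abs_of_pos hr0] at hz
    have h1 := mul_le_mul_of_nonneg_left (hHb _ (hmaps (hsph hz))).1 (poissonKernel_nonneg hc hz)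
    simpa using h1

/-- The outer radius tends to `1`; by compactness `φ` maps the closed disc of radius `r` into a
strictly smaller disc. Centring at `c` pays off when `φ c` is near `0`, since the constant is then
near `1`. -/
theorem HardySpace.circleAverage_poissonKernel_mul_sq_comp_le (φ : 𝔻 → 𝔻)
    (hφ : IsHolomorphic fun z => (φ z : ℂ)) (f : HardySpace) {r : ℝ} (h1 : r < 1) {c : 𝔻}
    (hc : (c : ℂ) ∈ ball (0 : ℂ) r) :
    Real.circleAverage
      (fun z => poissonKernel 0 c z * ‖extendZero (HardySpace.toFun f ∘ φ) z‖ ^ 2) 0 r ≤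
      (1 + ‖(φ c : ℂ)‖) / (1 - ‖(φ c : ℂ)‖) * ‖f‖ ^ 2 := by
  have h0 : 0 < r := pos_of_mem_ball hc
  set Φ : ℂ → ℂ := extendZero fun z => (φ z : ℂ) with hΦ
  have hΦc : Φ c = φ c := extendZero_coe _ c
  have hb : ‖(φ c : ℂ)‖ < 1 := (φ c).norm_lt_one
  have hsub : closedBall (0 : ℂ) r ⊆ ball 0 1 := closedBall_subset_ball h1
  obtain ⟨σ, hσ1, hσ⟩ : ∃ σ < 1, ∀ z ∈ closedBall (0 : ℂ) r, ‖Φ z‖ ≤ σ := by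
    obtain ⟨z₀, hz₀, hmax⟩ := (isCompact_closedBall (0 : ℂ) r).exists_isMaxOn
      ⟨0, by simpa using h0.le⟩ (hφ.continuousOn.mono hsub).norm
    refine ⟨‖Φ z₀‖, ?_, fun z hz => hmax hz⟩
    have hz1 : ‖z₀‖ < 1 := by simpa using hsub hz₀
    rw [hΦ, extendZero_of_norm_lt _ hz1]
    exact (φ _).norm_lt_one
  have hcongr : Real.circleAverage
      (fun z => poissonKernel 0 c z * ‖extendZero (HardySpace.toFun f ∘ φ) z‖ ^ 2) 0 r =
      Real.circleAverage (fun z => poissonKernel 0 c z * ‖extendZero f (Φ z)‖ ^ 2) 0 r := by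
    refine Real.circleAverage_congr_sphere fun z hz => ?_
    rw [abs_of_pos h0, mem_sphere_zero_iff_norm] at hz
    have hz1 : ‖z‖ < 1 := by linarith
    simp [hΦ, extendZero_of_norm_lt _ hz1]
  rw [hcongr]
  have hest : ∀ᶠ ρ : ℝ in 𝓝[<] (1 : ℝ),
      Real.circleAverage (fun z => poissonKernel 0 c z * ‖extendZero f (Φ z)‖ ^ 2) 0 r ≤
      (ρ + ‖(φ c : ℂ)‖) / (ρ - ‖(φ c : ℂ)‖) * ‖f‖ ^ 2 := by
    filter_upwards [HardySpace.eventually_mem_Ioo, Ioo_mem_nhdsLT hσ1] with ρ hρ hρσ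
    have hmaps : Set.MapsTo Φ (closedBall 0 r) (ball 0 ρ) := fun z hz => by
      rw [mem_ball_zero_iff]
      exact (hσ z hz).trans_lt hρσ.1
    have h := HardyDisc.circleAverage_poissonKernel_mul_sq_comp_le f.isHolomorphic hφ h1 hρ.2
      hmaps hc
    have hlt : ‖Φ c‖ < ρ := by simpa using hmaps (ball_subset_closedBall hc)
    rw [← hΦ, hΦc] at h
    rw [hΦc] at hlt
    refine h.trans (mul_le_mul_of_nonneg_left (f.circleSqMean_le_norm_sq hρ.1 hρ.2) ?_)
    exact div_nonneg (by linarith [norm_nonneg (φ c : ℂ)]) (by linarith)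
  refine ge_of_tendsto ?_ hest
  have hne : (1 : ℝ) - ‖(φ c : ℂ)‖ ≠ 0 := by linarith
  have hcont : ContinuousAt (fun ρ : ℝ => (ρ + ‖(φ c : ℂ)‖) / (ρ - ‖(φ c : ℂ)‖) * ‖f‖ ^ 2) 1 :=
    (ContinuousAt.div (continuousAt_id.add continuousAt_const)
      (continuousAt_id.sub continuousAt_const) hne).mul continuousAt_const
  exact hcont.tendsto.mono_left nhdsWithin_le_nhds

/-! ### The weighted composition isometry -/

theorem one_sub_norm_le_norm_one_sub_conj_mul (b z : 𝔻) :
    1 - ‖(b : ℂ)‖ ≤ ‖1 - conj (b : ℂ) * z‖ := by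
  have h := norm_sub_norm_le (1 : ℂ) (conj (b : ℂ) * z)
  rw [norm_mul, RCLike.norm_conj, norm_one] at h
  have : ‖(b : ℂ)‖ * ‖(z : ℂ)‖ ≤ ‖(b : ℂ)‖ * 1 :=
    mul_le_mul_of_nonneg_left z.norm_lt_one.le (norm_nonneg _)
  linarith

/-- The product of a function in the Hardy space with the reproducing kernel at `b`. -/
def mulKernel (b : 𝔻) (f : HardySpace) : HardySpace :=
  HardySpace.mul (fun z => 1 / (1 - conj (b : ℂ) * z))
    (isHolomorphic_of_differentiableOn (F := fun z : ℂ => 1 / (1 - conj (b : ℂ) * z))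
      (DifferentiableOn.div (by fun_prop) (by fun_prop) fun _ hz =>
        one_sub_conj_mul_ne_zero b.norm_lt_one (mem_ball_zero_iff.1 hz).le))
    (C := 1 / (1 - ‖(b : ℂ)‖))
    (fun z => by
      rw [norm_div, norm_one]
      exact one_div_le_one_div_of_le (by linarith [b.norm_lt_one])
        (one_sub_norm_le_norm_one_sub_conj_mul b z)) f

theorem mulKernel_apply (b : 𝔻) (f : HardySpace) (z : 𝔻) :
    mulKernel b f z = 1 / (1 - conj (b : ℂ) * z) * f z := rfl

theorem autCompositionOperator_apply (φ : discAut) (f : HardySpace) (z : 𝔻) :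
    autCompositionOperator φ f z = f ((φ : Equiv.Perm 𝔻) z) := rfl

/-- On `‖z‖ = r` one has `z * conj z = r²`, hence `‖z - r² b‖ = r ‖1 - conj b * z‖`. Thus the
squared modulus of the reproducing kernel at `b` is a multiple of the Poisson kernel at `r² b`. -/
theorem poissonKernel_eq_div_norm_one_sub_conj_mul {b z : ℂ} {r : ℝ} (hr : 0 < r) (hz : ‖z‖ = r) :
    poissonKernel 0 (r ^ 2 * b) z = (1 - r ^ 2 * ‖b‖ ^ 2) / ‖1 - conj b * z‖ ^ 2 := by
  have h1 : ‖z - r ^ 2 * b‖ = r * ‖1 - conj b * z‖ := by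
    have h2 : z - r ^ 2 * b = z * conj (1 - conj b * z) := by
      have : z * conj z = (r : ℂ) ^ 2 := by rw [Complex.mul_conj', hz]
      simp only [map_sub, map_one, map_mul, Complex.conj_conj]
      linear_combination b * this
    rw [h2, norm_mul, hz, RCLike.norm_conj]
  have h3 : ‖(r : ℂ) ^ 2 * b‖ = r ^ 2 * ‖b‖ := by
    rw [norm_mul, norm_pow, Complex.norm_real, Real.norm_of_nonneg hr.le]
  rw [poissonKernel_def, sub_zero, sub_zero, h1, hz, h3, mul_pow r,
    ← mul_div_mul_left (1 - r ^ 2 * ‖b‖ ^ 2) (‖1 - conj b * z‖ ^ 2) (pow_pos hr 2).ne']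
  congr 1
  ring

/-- The weight `(1 - ‖b‖²) / ‖1 - conj b * z‖²` is at most the Poisson kernel at `r² b`.
Subordination gives the constant `(1 + ε r) / (1 - ε r)`, which tends to `1`. -/
theorem norm_mulKernel_autCompositionOperator_le (b : 𝔻) (f : HardySpace) :
    (1 - ‖(b : ℂ)‖ ^ 2) * ‖mulKernel b (autCompositionOperator (moebius b) f)‖ ^ 2 ≤ ‖f‖ ^ 2 := by
  have hb1 : 0 < 1 - ‖(b : ℂ)‖ ^ 2 := by linarith [b.sq_norm_lt_one]
  -- The image of `r² b` under the involution, which tends to `0` as `r → 1`.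
  set ε : ℝ → ℝ := fun r => ‖((b : ℂ) - r ^ 2 * b) / (1 - conj (b : ℂ) * (r ^ 2 * b))‖ with hε
  have hden : (1 : ℂ) - conj (b : ℂ) * b ≠ 0 :=
    one_sub_conj_mul_ne_zero b.norm_lt_one b.norm_lt_one.le
  have hεc : ContinuousAt ε 1 := by
    refine (ContinuousAt.div (by fun_prop) (by fun_prop) ?_).norm
    simpa using hden
  have hε1 : ε 1 = 0 := by simp [hε]
  have hlim : Tendsto (fun r => (1 + ε r) / (1 - ε r) * ‖f‖ ^ 2) (𝓝[<] (1 : ℝ))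
      (𝓝 (‖f‖ ^ 2)) := by
    have hc : ContinuousAt (fun r => (1 + ε r) / (1 - ε r) * ‖f‖ ^ 2) 1 :=
      ((continuousAt_const.add hεc).div (continuousAt_const.sub hεc) (by simp [hε1])).mul
        continuousAt_const
    have := hc.tendsto.mono_left (nhdsWithin_le_nhds (s := Set.Iio 1))
    simpa [hε1] using this
  refine le_of_tendsto_of_tendsto
    ((HardySpace.tendsto_circleSqMean _).const_mul (1 - ‖(b : ℂ)‖ ^ 2)) hlim ?_
  filter_upwards [HardySpace.eventually_mem_Ioo] with r hr
  have hcr : ‖(r : ℂ) ^ 2 * b‖ < r := by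
    rw [norm_mul, norm_pow, Complex.norm_real, Real.norm_of_nonneg hr.1.le]
    have h1 : r ^ 2 * ‖(b : ℂ)‖ ≤ r ^ 2 * 1 :=
      mul_le_mul_of_nonneg_left b.norm_lt_one.le (sq_nonneg r)
    nlinarith [hr.1, hr.2]
  have h := HardySpace.circleAverage_poissonKernel_mul_sq_comp_le (moebius b : Equiv.Perm 𝔻)
    (moebius b).2.1 f hr.2 (c := UnitDisc.mk _ (hcr.trans hr.2)) (mem_ball_zero_iff.2 hcr)
  rw [coe_moebius, UnitDisc.coe_mk] at h
  refine le_trans ?_ h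
  have hH := (mulKernel b (autCompositionOperator (moebius b) f)).isHolomorphic
  have hcomp := (autCompositionOperator (moebius b) f).isHolomorphic
  have hsph : sphere (0 : ℂ) r ⊆ ball 0 1 := fun z hz =>
    mem_ball_zero_iff.2 ((mem_sphere_zero_iff_norm.1 hz).trans_lt hr.2)
  rw [circleSqMean, ← smul_eq_mul, ← Real.circleAverage_fun_smul]
  apply Real.circleAverage_mono
  · exact circleIntegrable_of_continuousOn 
      (by have := hH.continuousOn; fun_prop) hr.1.le hr.2
  · exact ContinuousOn.circleIntegrable hr.1.le
      ((continuousOn_poissonKernel_sphere (mem_ball_zero_iff.2 hcr)).mul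
        ((hcomp.continuousOn.mono hsph).norm.pow 2))
  · intro z hz
    rw [abs_of_pos hr.1, mem_sphere_zero_iff_norm] at hz
    have hz1 : ‖z‖ < 1 := hz.trans_lt hr.2
    rw [poissonKernel_eq_div_norm_one_sub_conj_mul hr.1 hz, extendZero_of_norm_lt _ hz1,
      extendZero_of_norm_lt _ hz1, mulKernel_apply, autCompositionOperator_apply, UnitDisc.coe_mk,
      norm_mul, mul_pow, norm_div, norm_one, div_pow, one_pow, smul_eq_mul, ← mul_assoc,
      mul_one_div]
    have hr2 : r ^ 2 ≤ 1 := pow_le_one₀ hr.1.le hr.2.le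
    have : r ^ 2 * ‖(b : ℂ)‖ ^ 2 ≤ 1 * ‖(b : ℂ)‖ ^ 2 :=
      mul_le_mul_of_nonneg_right hr2 (sq_nonneg _)
    refine mul_le_mul_of_nonneg_right (div_le_div_of_nonneg_right ?_ (sq_nonneg _)) (sq_nonneg _)
    linarith

/-- The two kernel factors cancel through `(1 - conj b * φ z) (1 - conj b * z) = 1 - ‖b‖²`. -/
theorem mulKernel_autCompositionOperator_twice (b : 𝔻) (f : HardySpace) :
    ((1 - ‖(b : ℂ)‖ ^ 2 : ℝ) : ℂ) • mulKernel b (autCompositionOperator (moebius b)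
      (mulKernel b (autCompositionOperator (moebius b) f))) = f := by
  ext z
  have hinv : (moebius b : Equiv.Perm 𝔻) ((moebius b : Equiv.Perm 𝔻) z) = z :=
    UnitDisc.coe_injective (moebius_moebius b.norm_lt_one z.norm_lt_one)
  have h1 := one_sub_conj_mul_ne_zero b.norm_lt_one z.norm_lt_one.le
  have h2 := one_sub_conj_mul_ne_zero b.norm_lt_one
    ((moebius b : Equiv.Perm 𝔻) z).norm_lt_one.le
  have h3 : (1 - conj (b : ℂ) * ((moebius b : Equiv.Perm 𝔻) z : ℂ)) * (1 - conj (b : ℂ) * z) =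
      ((1 - ‖(b : ℂ)‖ ^ 2 : ℝ) : ℂ) := by
    have h4 : ((moebius b : Equiv.Perm 𝔻) z : ℂ) * (1 - conj (b : ℂ) * z) = b - z := by
      rw [coe_moebius, div_mul_cancel₀ _ h1]
    have h5 : conj (b : ℂ) * b = (‖(b : ℂ)‖ : ℂ) ^ 2 := Complex.conj_mul' _
    push_cast
    linear_combination -conj (b : ℂ) * h4 - h5
  rw [HardySpace.smul_apply, mulKernel_apply, autCompositionOperator_apply, mulKernel_apply,
    autCompositionOperator_apply, hinv, ← h3]
  field_simp

/-- After normalisation by `√(1 - ‖b‖²)` the operator is a contraction whose square is the identity,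
hence an isometry. -/
theorem norm_mulKernel_autCompositionOperator (b : 𝔻) (f : HardySpace) :
    (1 - ‖(b : ℂ)‖ ^ 2) * ‖mulKernel b (autCompositionOperator (moebius b) f)‖ ^ 2 = ‖f‖ ^ 2 := by
  have hb1 : 0 < 1 - ‖(b : ℂ)‖ ^ 2 := by linarith [b.sq_norm_lt_one]
  refine le_antisymm (norm_mulKernel_autCompositionOperator_le b f) ?_
  have h := norm_mulKernel_autCompositionOperator_le b
    (mulKernel b (autCompositionOperator (moebius b) f))
  have h2 := congrArg (fun g => ‖g‖ ^ 2) (mulKernel_autCompositionOperator_twice b f)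
  simp only [norm_smul, Complex.norm_real, Real.norm_of_nonneg hb1.le, mul_pow] at h2
  rw [← h2, sq (1 - ‖(b : ℂ)‖ ^ 2), mul_assoc]
  exact mul_le_mul_of_nonneg_left h hb1.le

/-- `C_φ`, with `φ` the involution exchanging `0` and `b`, is a multiple of an isometry composed
with the division by `1 - conj b * z`. -/
theorem norm_autCompositionOperator_sub_smul_shift (b : 𝔻) (u : HardySpace) :
    ‖autCompositionOperator (moebius b) (u - conj (b : ℂ) • HardySpace.shift u)‖ ^ 2 =
      (1 - ‖(b : ℂ)‖ ^ 2) * ‖u‖ ^ 2 := by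
  have hb1 : 0 < 1 - ‖(b : ℂ)‖ ^ 2 := by linarith [b.sq_norm_lt_one]
  have h : autCompositionOperator (moebius b) (u - conj (b : ℂ) • HardySpace.shift u) =
      ((1 - ‖(b : ℂ)‖ ^ 2 : ℝ) : ℂ) • mulKernel b (autCompositionOperator (moebius b) u) := by
    ext z
    have h1 := one_sub_conj_mul_ne_zero b.norm_lt_one z.norm_lt_one.le
    have h5 : conj (b : ℂ) * b = (‖(b : ℂ)‖ : ℂ) ^ 2 := Complex.conj_mul' _
    rw [HardySpace.smul_apply, mulKernel_apply, autCompositionOperator_apply,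
      autCompositionOperator_apply, HardySpace.sub_apply, HardySpace.smul_apply,
      HardySpace.shift_apply, coe_moebius]
    push_cast
    rw [← h5]
    field_simp
    ring
  rw [h, norm_smul, Complex.norm_real, Real.norm_of_nonneg hb1.le, mul_pow, sq (1 - _), mul_assoc,
    norm_mulKernel_autCompositionOperator]

/-- Division by `1 - conj b * z` stays in the Hardy space, so the norm formula above covers every
`f`. -/
theorem exists_eq_sub_smul_shift (b : 𝔻) (f : HardySpace) :
    ∃ u : HardySpace, f = u - conj (b : ℂ) • HardySpace.shift u := by
  refine ⟨mulKernel b f, HardySpace.ext fun z => ?_⟩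
  have h1 := one_sub_conj_mul_ne_zero b.norm_lt_one z.norm_lt_one.le
  rw [HardySpace.sub_apply, HardySpace.smul_apply, HardySpace.shift_apply, mulKernel_apply]
  field_simp

/-! ### The norm of the composition operator: sharp and not attained -/

theorem exists_unit_conj_eq {b : ℂ} (hb : b ≠ 0) :
    ∃ η : ℂ, ‖η‖ = 1 ∧ conj b = (‖b‖ : ℂ) * η := by
  have hn : (‖b‖ : ℂ) ≠ 0 := by simpa using hb
  exact ⟨conj b / ‖b‖, by simp [hb], by field_simp⟩

/-- With `κ = ‖b‖`, the quotient `‖C_φ f‖² / ‖f‖²` equals `(1 - κ²) ‖u‖² / ‖u - κ η S u‖²`, and the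
denominator strictly exceeds `(1 - κ)² ‖u‖²`. -/
theorem norm_autCompositionOperator_moebius_lt {b : 𝔻} (hb : b ≠ 0) {f : HardySpace} (hf : f ≠ 0) :
    (1 - ‖(b : ℂ)‖) * ‖autCompositionOperator (moebius b) f‖ ^ 2 < (1 + ‖(b : ℂ)‖) * ‖f‖ ^ 2 := by
  have hb' : (b : ℂ) ≠ 0 := by simpa using hb
  have hb0 : 0 < ‖(b : ℂ)‖ := norm_pos_iff.2 hb'
  have hb1 := b.norm_lt_one
  obtain ⟨u, hu⟩ := exists_eq_sub_smul_shift b f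
  obtain ⟨η, hη, hbη⟩ := exists_unit_conj_eq hb'
  have hu0 : u ≠ 0 := by
    rintro rfl
    refine hf (hu.trans (HardySpace.ext fun z => ?_))
    rw [HardySpace.sub_apply, HardySpace.smul_apply, HardySpace.shift_apply, HardySpace.zero_apply]
    ring
  have hlt := HardySpace.lt_norm_sub_smul_shift hu0 hη hb0
  rw [← hbη, ← hu] at hlt
  have hT := norm_autCompositionOperator_sub_smul_shift b u
  rw [← hu] at hT
  rw [hT]
  have hlt2 := pow_lt_pow_left₀ hlt (by have := norm_nonneg u; nlinarith) two_ne_zero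
  have := mul_lt_mul_of_pos_left hlt2 (by linarith : 0 < 1 + ‖(b : ℂ)‖)
  linarith

/-- Taking `u` to be the `n`-th geometric sum, `‖C_φ f‖² / ‖f‖²` tends to `(1 + ‖b‖) / (1 - ‖b‖)`,
which exceeds `(1 + δ) / (1 - δ)`. -/
theorem exists_lt_norm_autCompositionOperator_moebius {b : 𝔻} (hb : b ≠ 0) {δ : ℝ} (hδ0 : 0 < δ)
    (hδ : δ < ‖(b : ℂ)‖) : ∃ f : HardySpace, f ≠ 0 ∧
      (1 + δ) * ‖f‖ ^ 2 < (1 - δ) * ‖autCompositionOperator (moebius b) f‖ ^ 2 := by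
  have hb' : (b : ℂ) ≠ 0 := by simpa using hb
  have hb0 : 0 < ‖(b : ℂ)‖ := norm_pos_iff.2 hb'
  have hb1 := b.norm_lt_one
  obtain ⟨η, hη, hbη⟩ := exists_unit_conj_eq hb'
  have hlim : Tendsto (fun n : ℕ => (1 + δ) * ((1 - ‖(b : ℂ)‖) + 2 * ‖(b : ℂ)‖ * (√n)⁻¹) ^ 2) atTop
      (𝓝 ((1 + δ) * ((1 - ‖(b : ℂ)‖) + 2 * ‖(b : ℂ)‖ * 0) ^ 2)) := by
    have h0 : Tendsto (fun n : ℕ => (√(n : ℝ))⁻¹) atTop (𝓝 0) :=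
      tendsto_inv_atTop_zero.comp (Real.tendsto_sqrt_atTop.comp tendsto_natCast_atTop_atTop)
    exact (((h0.const_mul _).const_add _).pow 2).const_mul _
  have hval : (1 + δ) * ((1 - ‖(b : ℂ)‖) + 2 * ‖(b : ℂ)‖ * 0) ^ 2 <
      (1 - δ) * (1 - ‖(b : ℂ)‖ ^ 2) := by
    have h1 : (1 + δ) * (1 - ‖(b : ℂ)‖) < (1 - δ) * (1 + ‖(b : ℂ)‖) := by linarith
    have := mul_lt_mul_of_pos_left h1 (by linarith : 0 < 1 - ‖(b : ℂ)‖)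
    linarith
  obtain ⟨n, hn, hn0⟩ := ((hlim.eventually_lt_const hval).and (eventually_gt_atTop 0)).exists
  have hnp : (0 : ℝ) < n := by exact_mod_cast hn0
  have hsq : √(n : ℝ) ^ 2 = n := Real.sq_sqrt hnp.le
  have hs0 : 0 < √(n : ℝ) := Real.sqrt_pos.2 hnp
  set u := HardySpace.geomSum η n with hu
  set f := u - conj (b : ℂ) • HardySpace.shift u with hf
  have hle : ‖f‖ ≤ (1 - ‖(b : ℂ)‖) * √n + 2 * ‖(b : ℂ)‖ := by
    rw [hf, hbη]
    exact HardySpace.norm_geomSum_sub_smul_shift_le hη hb0.le hb1.le n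
  have hT : ‖autCompositionOperator (moebius b) f‖ ^ 2 = (1 - ‖(b : ℂ)‖ ^ 2) * n := by
    rw [hf, norm_autCompositionOperator_sub_smul_shift, hu, HardySpace.norm_geomSum_sq hη]
  have key : (1 + δ) * ‖f‖ ^ 2 < (1 - δ) * ‖autCompositionOperator (moebius b) f‖ ^ 2 := by
    rw [hT]
    calc (1 + δ) * ‖f‖ ^ 2 ≤ (1 + δ) * ((1 - ‖(b : ℂ)‖) * √n + 2 * ‖(b : ℂ)‖) ^ 2 := by gcongr
      _ = (1 + δ) * ((1 - ‖(b : ℂ)‖) + 2 * ‖(b : ℂ)‖ * (√n)⁻¹) ^ 2 * √(n : ℝ) ^ 2 := by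
        field_simp
      _ < (1 - δ) * (1 - ‖(b : ℂ)‖ ^ 2) * √(n : ℝ) ^ 2 := by gcongr
      _ = (1 - δ) * ((1 - ‖(b : ℂ)‖ ^ 2) * n) := by rw [hsq]; ring
  refine ⟨f, fun h0 => ?_, key⟩
  rw [h0] at key
  simp at key

/-! ### Conclusion -/

theorem numericalRange_moebius {b : 𝔻} (hb : b ≠ 0) {s : ℝ} (hs0 : 0 < s)
    (hs : s ^ 2 * (1 - ‖(b : ℂ)‖ ^ 2) = 1) :
    numericalRange (autCompositionOperator (moebius b)) = openEllipse 1 (-1) s := by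
  have hb0 : 0 < ‖(b : ℂ)‖ := norm_pos_iff.2 (by simpa using hb)
  have hinv : ∀ f, autCompositionOperator (moebius b) (autCompositionOperator (moebius b) f) = f :=
    fun f => HardySpace.ext fun z => congrArg f
      (UnitDisc.coe_injective (moebius_moebius b.norm_lt_one z.norm_lt_one))
  ext w
  rw [mem_openEllipse_one_neg_one_iff hb0 b.norm_lt_one hs0 hs]
  exact ⟨numericalRange_involution_subset hb0 b.norm_lt_one hinv fun _ =>
      norm_autCompositionOperator_moebius_lt hb,
    subset_numericalRange_involution hb0 b.norm_lt_one hinv fun _ =>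
      exists_lt_norm_autCompositionOperator_moebius hb⟩

end HardyDisc
end

theorem mainTheorem1 (φ : HardyDisc.discAut) (hφ : HardyDisc.IsElliptic φ) (hord : orderOf φ = 2)
    (a : Complex.UnitDisc) (hfix : (φ : Equiv.Perm Complex.UnitDisc) a = a) (ha : a ≠ 0) :
    HardyDisc.numericalRange (HardyDisc.autCompositionOperator φ) =
        HardyDisc.openEllipse 1 (-1) ((1 + ‖(a : ℂ)‖ ^ 2) / (1 - ‖(a : ℂ)‖ ^ 2)) ∧
      ∀ w ∈ frontier (HardyDisc.openEllipse 1 (-1) ((1 + ‖(a : ℂ)‖ ^ 2) / (1 - ‖(a : ℂ)‖ ^ 2))),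
        w ∉ HardyDisc.numericalRange (HardyDisc.autCompositionOperator φ) := by
  have h : HardyDisc.numericalRange (HardyDisc.autCompositionOperator φ) =
      HardyDisc.openEllipse 1 (-1) ((1 + ‖(a : ℂ)‖ ^ 2) / (1 - ‖(a : ℂ)‖ ^ 2)) := by
    have hφb := HardyDisc.eq_moebius_of_orderOf_eq_two φ hord hfix ha
    generalize (φ : Equiv.Perm Complex.UnitDisc) 0 = b at hφb
    subst hφb
    have hb := HardyDisc.norm_of_moebius_fixed hfix ha
    have ha0 : 0 < ‖(a : ℂ)‖ := norm_pos_iff.2 (by simpa using ha)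
    have ha1 : 0 < 1 - ‖(a : ℂ)‖ ^ 2 := by linarith [a.sq_norm_lt_one]
    have hb0 : b ≠ 0 := by
      rintro rfl
      rw [Complex.UnitDisc.coe_zero, norm_zero] at hb
      have : 0 < 2 * ‖(a : ℂ)‖ / (1 + ‖(a : ℂ)‖ ^ 2) := by positivity
      linarith
    -- From the formula for `‖b‖`, `1 - ‖b‖² = ((1 - ‖a‖²) / (1 + ‖a‖²))²`.
    refine HardyDisc.numericalRange_moebius hb0 (by positivity) ?_
    rw [hb]
    field_simp
    ring
  refine ⟨h, fun w hw => ?_⟩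
  rw [h]
  rw [(HardyDisc.isOpen_openEllipse _ _ _).frontier_eq] at hw
  exact hw.2
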